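/- Let $\mathbb X$ be a Polish space with its Borel $\sigma$-field, let $\alpha$ be a non-zero finite measure on $\mathbb X$ with total mass $a>0$, and let $\mathcal P_{\mathbb X}$ be the space of probability measures on $\mathbb X$ with the $\sigma$-field generated by the topology of weak convergence. Fix an integer $n\ge 1$. For $m\ge1$ let $\theta_m$ have the Beta distribution with parameter $(n,a)$, let $(q^{(n)}_{m,1},\dots,q^{(n)}_{m,n})$ have the Dirichlet distribution with parameter $(1,\dots,1)$, and let $(Y_{m,1},\dots,Y_{m,n})$ be distributed as the first $n$ terms of a Pólya sequence with parameter $\alpha$, i.e. $\mathbb P(Y_{m,1}\in A)=\alpha(A)/a$ and $$\mathbb P(Y_{m,j+1}\in A\mid Y_{m,1},\dots,Y_{m,j})=\frac{\alpha(A)+\sum_{i=1}^{j}\delta_{Y_{m,i}}(A)}{a+j},\qquad 1\le j<n,$$ for every Borel set $A$. Assume that all these random elements (the variables $\theta_m$, the vectors $q_m^{(n)}$ and the vectors $Y_m$, for all $m\ge1$) are mutually independent, and let $P^{(n)}_0$ be an arbitrary $\mathcal P_{\mathbb X}$-valued initial state independent of them. Define $$P^{(n)}_m=\theta_m\sum_{i=1}^n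 q^{(n)}_{m,i}\,\delta_{Y_{m,i}}+(1-\theta_m)P^{(n)}_{m-1},\qquad m\ge 1 .$$ Then $\{P^{(n)}_m,\,m\ge0\}$ is a time-homogeneous Markov chain on $\mathcal P_{\mathbb X}$ whose transition kernel sends $\mu\in\mathcal P_{\mathbb X}$ to the law of $\theta_1\sum_{i=1}^n q^{(n)}_{1,i}\delta_{Y_{1,i}}+(1-\theta_1)\mu$. This kernel has exactly one invariant probability measure $\Pi$ on $\mathcal P_{\mathbb X}$, and $\Pi$ is the law of a Dirichlet process $P$ with parameter $\alpha$: for every finite measurable partition $B_1,\dots,B_k$ of $\mathbb X$, the vector $(P(B_1),\dots,P(B_k))$ has the Dirichlet distribution with parameter $(\alpha(B_1),\dots,\alpha(B_k))$, where components with $\alpha(B_i)=0$ are equal to $0$ almost surely. -/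

import Mathlib

open MeasureTheory ProbabilityTheory

namespace FeiginTweedie

/-- The Dirichlet distribution with parameters `a i ≥ 0` (at least one of them positive), as a law
on `ι → ℝ`: the law of `(Z i / ∑ j, Z j)_i` for independent `Z i ∼ Gamma (a i, 1)`, where
`Gamma (0, 1)` is the unit mass at `0`. -/
noncomputable def dirichletMeasure {ι : Type*} [Fintype ι] (a : ι → ℝ) : Measure (ι → ℝ) :=
  (Measure.pi fun i => if a i = 0 then Measure.dirac 0 else gammaMeasure (a i) 1).map
    fun z i => z i / ∑ j, z j

lemma isProbabilityMeasure_dirichletMeasure {ι : Type*} [Fintype ι] {a : ι → ℝ}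
    (ha : ∀ i, 0 ≤ a i) : IsProbabilityMeasure (dirichletMeasure a) := by
  have (i : ι) : IsProbabilityMeasure
      (if a i = 0 then Measure.dirac 0 else gammaMeasure (a i) 1) := by
    split_ifs with h
    · infer_instance
    · exact isProbabilityMeasure_gammaMeasure (lt_of_le_of_ne (ha i) (Ne.symm h)) one_pos
  exact Measure.isProbabilityMeasure_map (by fun_prop)

section Chain

variable {X : Type*} [MeasurableSpace X]

lemma measurable_sum_dirac {j : ℕ} :
    Measurable fun y : Fin j → X => ∑ i, Measure.dirac (y i) :=
  Finset.measurable_fun_sum _ fun i _ => Measure.measurable_dirac.comp (measurable_pi_apply i)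

/-- The predictive distribution of the next term of a Pólya sequence with parameter `α`, given the
first `j` terms `y`: `(α + ∑ i, δ_{y i}) / (α(X) + j)`. -/
noncomputable def polyaPredictive (α : Measure X) (j : ℕ) : Kernel (Fin j → X) X where
  toFun y := (α Set.univ + j)⁻¹ • (α + ∑ i, Measure.dirac (y i))
  measurable' := by
    refine Measure.measurable_of_measurable_coe _ fun s hs => ?_
    simp only [Measure.smul_apply, Measure.add_apply, smul_eq_mul]
    exact (((Measure.measurable_coe hs).comp measurable_sum_dirac).const_add _).const_mul _

/-- The law of the first `n` terms `(Y₁, …, Yₙ)` of a Pólya sequence with parameter `α`. -/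
noncomputable def polyaLaw (α : Measure X) : (n : ℕ) → Measure (Fin n → X)
  | 0 => Measure.dirac Fin.elim0
  | n + 1 => (polyaLaw α n ⊗ₘ polyaPredictive α n).map
      fun p => (Fin.snoc p.1 p.2 : Fin (n + 1) → X)

/-- The measure `t ∑ i, q i δ_{y i} + (1 - t) μ`. -/
noncomputable def mixture {n : ℕ} (t : ℝ) (q : Fin n → ℝ) (y : Fin n → X) (μ : Measure X) :
    Measure X :=
  ENNReal.ofReal t • ∑ i, ENNReal.ofReal (q i) • Measure.dirac (y i) + ENNReal.ofReal (1 - t) • μ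

/-- The law of `(θ, (q₁, …, qₙ), (Y₁, …, Yₙ))` with mutually independent components
`θ ∼ Beta (n, α(X))`, `q ∼ Dirichlet (1, …, 1)`, and `(Y₁, …, Yₙ)` the first `n` terms of a Pólya
sequence with parameter `α`. -/
noncomputable def innovationLaw (α : Measure X) (n : ℕ) :
    Measure (ℝ × (Fin n → ℝ) × (Fin n → X)) :=
  (betaMeasure n (α.real Set.univ)).prod ((dirichletMeasure fun _ : Fin n => 1).prod (polyaLaw α n))

open Classical in
/-- One step of the chain from the state `μ`, driven by `z = (θ, q, y)`. When `θ ∈ [0, 1]` and `q`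
lies in the simplex, hence almost surely for the law of the innovations, the new state is
`θ ∑ i, q i δ_{y i} + (1 - θ) μ`; on the exceptional null set the state does not move. -/
noncomputable def step {n : ℕ} (μ : ProbabilityMeasure X) (z : ℝ × (Fin n → ℝ) × (Fin n → X)) :
    ProbabilityMeasure X :=
  if h : IsProbabilityMeasure (mixture z.1 z.2.1 z.2.2 (μ : Measure X)) then
    ⟨mixture z.1 z.2.1 z.2.2 (μ : Measure X), h⟩
  else μ

lemma measurable_mixture {n : ℕ} :
    Measurable fun w : ProbabilityMeasure X × (ℝ × (Fin n → ℝ) × (Fin n → X)) =>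
      mixture w.2.1 w.2.2.1 w.2.2.2 (w.1 : Measure X) := by
  refine Measure.measurable_of_measurable_coe _ fun s hs => ?_
  simp only [mixture, Measure.add_apply, Measure.smul_apply, Measure.finsetSum_apply, smul_eq_mul]
  have h1 : Measurable fun w : ProbabilityMeasure X × (ℝ × (Fin n → ℝ) × (Fin n → X)) =>
      (w.1 : Measure X) s :=
    (Measure.measurable_coe hs).comp (measurable_subtype_coe.comp measurable_fst)
  have h2 (i : Fin n) : Measurable
      fun w : ProbabilityMeasure X × (ℝ × (Fin n → ℝ) × (Fin n → X)) =>
        Measure.dirac (w.2.2.2 i) s :=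
    (Measure.measurable_coe hs).comp (Measure.measurable_dirac.comp (by fun_prop))
  fun_prop

lemma measurable_step {n : ℕ} :
    Measurable fun w : ProbabilityMeasure X × (ℝ × (Fin n → ℝ) × (Fin n → X)) =>
      step w.1 w.2 := by
  classical
  refine Measurable.subtype_mk (f := fun w : ProbabilityMeasure X ×
    (ℝ × (Fin n → ℝ) × (Fin n → X)) => (step w.1 w.2 : Measure X)) ?_
  have : (fun w : ProbabilityMeasure X × (ℝ × (Fin n → ℝ) × (Fin n → X)) =>
      (step w.1 w.2 : Measure X)) = fun w =>
        if IsProbabilityMeasure (mixture w.2.1 w.2.2.1 w.2.2.2 (w.1 : Measure X)) then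
          mixture w.2.1 w.2.2.1 w.2.2.2 (w.1 : Measure X) else (w.1 : Measure X) := by
    funext w
    by_cases h : IsProbabilityMeasure (mixture w.2.1 w.2.2.1 w.2.2.2 (w.1 : Measure X)) <;>
      simp [step, h]
  rw [this]
  exact Measurable.ite (measurable_mixture ProbabilityMeasure.measurableSet_isProbabilityMeasure)
    measurable_mixture (measurable_subtype_coe.comp measurable_fst)

/-- The transition kernel of the chain on the space of probability measures on `X`: from `μ` the
chain moves to `θ ∑ i, q i δ_{Y i} + (1 - θ) μ`, with `(θ, q, Y)` drawn from `innovationLaw α n`. -/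
noncomputable def transitionKernel (α : Measure X) (n : ℕ) :
    Kernel (ProbabilityMeasure X) (ProbabilityMeasure X) where
  toFun μ := (innovationLaw α n).map (step μ)
  measurable' := by
    have h : ∀ m : ℕ, SFinite (polyaLaw α m) := fun m => by
      cases m <;> (unfold polyaLaw; infer_instance)
    have := h n
    have hd := isProbabilityMeasure_dirichletMeasure (a := fun _ : Fin n => 1)
      fun _ => zero_le_one
    have hb : SFinite (betaMeasure n (α.real Set.univ)) := by
      unfold betaMeasure; infer_instance
    have hi : SFinite (innovationLaw α n) := by unfold innovationLaw; infer_instance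
    refine Measure.measurable_of_measurable_coe _ fun s hs => ?_
    have (μ : ProbabilityMeasure X) : (innovationLaw α n).map (step μ) s =
        innovationLaw α n (Prod.mk μ ⁻¹' ((fun w => step w.1 w.2) ⁻¹' s)) :=
      Measure.map_apply (measurable_step.comp measurable_prodMk_left) hs
    simp only [this]
    exact measurable_measure_prodMk_left (measurable_step hs)

/-- A realization of the chain on a probability space `(Ω, Pr)`. The innovations
`(θ m, q m, Y m)` drive the step from time `m` to time `m + 1`; they are independent over `m` with
common law `innovationLaw α n`, and independent of the initial state `P 0`, which is arbitrary
(possibly deterministic). -/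
structure IsChain (α : Measure X) (n : ℕ) {Ω : Type*} [MeasurableSpace Ω] (Pr : Measure Ω)
    (θ : ℕ → Ω → ℝ) (q : ℕ → Ω → Fin n → ℝ) (Y : ℕ → Ω → Fin n → X)
    (P : ℕ → Ω → ProbabilityMeasure X) : Prop where
  measurable_θ : ∀ m, Measurable (θ m)
  measurable_q : ∀ m, Measurable (q m)
  measurable_Y : ∀ m, Measurable (Y m)
  measurable_P : ∀ m, Measurable (P m)
  hasLaw : ∀ m, HasLaw (fun ω => (θ m ω, q m ω, Y m ω)) (innovationLaw α n) Pr
  iIndep : iIndepFun (fun m ω => (θ m ω, q m ω, Y m ω)) Pr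
  indep_initial : IndepFun (P 0) (fun ω m => (θ m ω, q m ω, Y m ω)) Pr
  recursion : ∀ m, ∀ᵐ ω ∂Pr,
    (P (m + 1) ω : Measure X) = mixture (θ m ω) (q m ω) (Y m ω) (P m ω : Measure X)

/-- `Q` is the law of a Dirichlet process with parameter `α`: for every finite measurable partition
`B` of `X`, the law under `Q` of `p ↦ (p (B i))_i` is the Dirichlet distribution with parameters
`(α (B i))_i`. -/
structure IsDirichletProcessLaw (α : Measure X) (Q : Measure (ProbabilityMeasure X)) : Prop where
  isProbabilityMeasure : IsProbabilityMeasure Q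
  map_eq : ∀ (k : ℕ) (B : Fin k → Set X), (∀ i, MeasurableSet (B i)) →
    Pairwise (fun i j => Disjoint (B i) (B j)) → ⋃ i, B i = Set.univ →
    Q.map (fun (p : ProbabilityMeasure X) i => (p : Measure X).real (B i)) = dirichletMeasure fun i => α.real (B i)

end Chain

end FeiginTweedie

/-! One step moves `μ` to `θ v + (1 - θ) μ` with `(θ, v)` random and `E(1 - θ) < 1`, a contraction
on average. For a finite measurable partition, the vector of cell masses obeys the same affine
recursion in a simplex, so most of the argument is finite-dimensional.

Dirichlet laws are stationary for the cell recursion. Fix the cells of the atoms `Y` and multiply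
the new state by an independent radius `t ∼ Gamma (n + a)`, where `a = α(X)`. Then `θ t ∼ Gamma n`
and `(1 - θ) t ∼ Gamma a` are independent, and each turns the Dirichlet vector it multiplies into
independent Gamma variables. Adding and normalising gives a Dirichlet vector whose parameters have
gained the counts of the atoms (`map_betaMeasure_prod_dirichletMeasure`). Averaging over the Pólya
sequence removes the counts again, because a Dirichlet law is the predictive mixture of its one-step
posteriors, which is size biasing of Gamma variables (`lintegral_polyaLaw_dirichletMeasure`).

By contraction a stationary law with bounded support is unique (`eq_of_stationary`). Hence the cell
masses under any invariant law are Dirichlet (`map_cellMass_of_invariant`), and these marginals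
determine the law on the space of probability measures (`IsDirichletProcessLaw.unique`).

An invariant law exists because the stick-breaking series of an i.i.d. sequence of innovations
undergoes exactly one step when an innovation is put in front, while the longer sequence is again
i.i.d. (`invariant_map_stickProbability`). Existence of the Dirichlet process is thus a consequence
and not an input.

The Markov property holds because the history up to time `m` is independent of all later innovations
(`IsChain.map_history_innovations`). -/

namespace FeiginTweedie

/-! ### Beta-Gamma algebra in dimension one. -/

section Gamma

open scoped ENNReal

@[fun_prop]
lemma measurable_gammaPDF (a r : ℝ) : Measurable (gammaPDF a r) :=
  (measurable_gammaPDFReal a r).ennreal_ofReal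

@[fun_prop]
lemma measurable_betaPDF (a b : ℝ) : Measurable (betaPDF a b) :=
  (measurable_betaPDFReal a b).ennreal_ofReal

lemma lintegral_gammaMeasure (a r : ℝ) {f : ℝ → ℝ≥0∞} (hf : Measurable f) :
    ∫⁻ x, f x ∂gammaMeasure a r = ∫⁻ x, gammaPDF a r x * f x :=
  lintegral_withDensity_eq_lintegral_mul _ (measurable_gammaPDF a r) hf

lemma lintegral_betaMeasure (a b : ℝ) {f : ℝ → ℝ≥0∞} (hf : Measurable f) :
    ∫⁻ x, f x ∂betaMeasure a b = ∫⁻ x, betaPDF a b x * f x :=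
  lintegral_withDensity_eq_lintegral_mul _ (measurable_betaPDF a b) hf

lemma lintegral_eq_mul_lintegral_comp_mul_left {c : ℝ} (hc : c ≠ 0) {f : ℝ → ℝ≥0∞}
    (hf : Measurable f) : ∫⁻ x, f x = ENNReal.ofReal |c| * ∫⁻ x, f (c * x) := by
  conv_lhs => rw [← Real.smul_map_volume_mul_left hc]
  rw [lintegral_smul_measure, lintegral_map hf (by fun_prop), smul_eq_mul]

lemma ae_pos_gammaMeasure (a r : ℝ) : ∀ᵐ x ∂gammaMeasure a r, 0 < x := by
  rw [gammaMeasure, ae_withDensity_iff (measurable_gammaPDF a r)]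
  filter_upwards [Measure.ae_ne volume (0 : ℝ)] with x hx h
  by_contra hx'
  exact h (gammaPDF_of_neg (lt_of_le_of_ne (not_lt.1 hx') hx))

lemma ae_mem_Ioo_betaMeasure (a b : ℝ) : ∀ᵐ x ∂betaMeasure a b, x ∈ Set.Ioo (0 : ℝ) 1 := by
  rw [betaMeasure, ae_withDensity_iff (measurable_betaPDF a b)]
  refine ae_of_all _ fun x h => ?_
  by_contra hx
  exact h (by rw [betaPDF_eq, if_neg (by simpa using hx), ENNReal.ofReal_zero])

/-- Change of variables `(u, v) = (x t, t - x t)` at the level of densities, with Jacobian `|t|`.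
The excluded values form null sets on which the boundary conventions of the densities can disagree.
-/
lemma betaPDFReal_mul_gammaPDFReal {p q t x : ℝ} (hp : 0 < p) (hq : 0 < q) (ht : t ≠ 0)
    (hx0 : x ≠ 0) (hx1 : x ≠ 1) :
    |t| * (gammaPDFReal p 1 (x * t) * gammaPDFReal q 1 (t - x * t)) =
      betaPDFReal p q x * gammaPDFReal (p + q) 1 t := by
  have hpq := Real.Gamma_pos_of_pos (add_pos hp hq)
  have hp' := Real.Gamma_pos_of_pos hp
  have hq' := Real.Gamma_pos_of_pos hq
  rcases lt_or_gt_of_ne ht with ht | ht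
  · rw [gammaPDFReal, gammaPDFReal, gammaPDFReal, if_neg ht.not_ge]
    split_ifs <;> first | (exfalso; linarith) | simp
  · rw [gammaPDFReal, gammaPDFReal, gammaPDFReal, betaPDFReal, if_pos ht.le, abs_of_pos ht]
    rcases lt_or_gt_of_ne hx0 with hx | hx
    · rw [if_neg (c := 0 ≤ x * t) (by nlinarith), if_neg (c := 0 < x ∧ x < 1) (by grind)]; simp
    rcases lt_or_gt_of_ne hx1 with hx' | hx'
    · have h1 : 0 < 1 - x := by linarith
      have : t - x * t = (1 - x) * t := by ring
      rw [this, if_pos (by positivity), if_pos (by positivity), if_pos ⟨hx, hx'⟩,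
        Real.mul_rpow hx.le ht.le, Real.mul_rpow h1.le ht.le, beta]
      have e1 : Real.exp (-(1 * t)) = Real.exp (-(1 * (x * t))) * Real.exp (-(1 * ((1 - x) * t))) := by
        rw [← Real.exp_add]; ring_nf
      have e2 : t ^ (p + q - 1) = t * (t ^ (p - 1) * t ^ (q - 1)) := by
        nth_rw 2 [← Real.rpow_one t]
        rw [← Real.rpow_add ht, ← Real.rpow_add ht]; ring_nf
      rw [e1, e2]
      simp only [Real.one_rpow]
      field_simp
    · rw [if_neg (c := 0 ≤ t - x * t) (by nlinarith), if_neg (c := 0 < x ∧ x < 1) (by grind)]; simp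

/-- If `θ ∼ Beta (p, q)` and `t ∼ Gamma (p + q)` are independent, then `θ t ∼ Gamma p` and
`(1 - θ) t ∼ Gamma q` are independent. -/
lemma map_betaMeasure_prod_gammaMeasure {p q : ℝ} (hp : 0 < p) (hq : 0 < q) :
    ((betaMeasure p q).prod (gammaMeasure (p + q) 1)).map
      (fun w => (w.1 * w.2, w.2 - w.1 * w.2)) =
      (gammaMeasure p 1).prod (gammaMeasure q 1) := by
  have := isProbabilityMeasureBeta hp hq
  have := isProbabilityMeasure_gammaMeasure hp one_pos
  have := isProbabilityMeasure_gammaMeasure hq one_pos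
  have := isProbabilityMeasure_gammaMeasure (add_pos hp hq) one_pos
  refine Measure.ext_of_lintegral _ fun f hf => ?_
  rw [lintegral_map hf (by fun_prop), lintegral_prod_symm _ (by fun_prop),
    lintegral_prod _ (by fun_prop), lintegral_gammaMeasure _ _ (by fun_prop),
    lintegral_gammaMeasure _ _ (by fun_prop)]
  -- The translation `v = t - u` makes the total `t` a variable of integration; after the swap, `u =
  -- t x` introduces the Beta variable.
  have h1 (u : ℝ) : gammaPDF p 1 u * ∫⁻ v, f (u, v) ∂gammaMeasure q 1 =
      ∫⁻ t, gammaPDF p 1 u * (gammaPDF q 1 (t - u) * f (u, t - u)) := by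
    rw [lintegral_gammaMeasure _ _ (by fun_prop), lintegral_const_mul _ (by fun_prop),
      lintegral_sub_right_eq_self (fun v => gammaPDF q 1 v * f (u, v)) u]
  simp_rw [h1]
  rw [lintegral_lintegral_swap (by fun_prop)]
  refine lintegral_congr_ae ?_
  filter_upwards [Measure.ae_ne volume (0 : ℝ)] with t ht
  rw [lintegral_eq_mul_lintegral_comp_mul_left ht (by fun_prop),
    lintegral_betaMeasure _ _ (by fun_prop), ← lintegral_const_mul _ (by fun_prop),
    ← lintegral_const_mul _ (by fun_prop)]
  refine lintegral_congr_ae ?_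
  filter_upwards [Measure.ae_ne volume (0 : ℝ), Measure.ae_ne volume (1 : ℝ)] with x hx0 hx1
  have := congrArg ENNReal.ofReal (betaPDFReal_mul_gammaPDFReal hp hq ht hx0 hx1)
  rw [ENNReal.ofReal_mul (abs_nonneg t), ENNReal.ofReal_mul (gammaPDFReal_nonneg hp one_pos _),
    ENNReal.ofReal_mul' (gammaPDFReal_nonneg (add_pos hp hq) one_pos _)] at this
  simp only [gammaPDF, betaPDF]
  rw [mul_comm t x]
  calc _ = ENNReal.ofReal (betaPDFReal p q x) * ENNReal.ofReal (gammaPDFReal (p + q) 1 t) *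
        f (x * t, t - x * t) := by ring
    _ = _ := by rw [← this]; ring

/-- The Gamma distribution with shape `a ≥ 0` and rate `1`, where `Gamma (0, 1)` is the unit mass
at `0`. -/
noncomputable def gammaOrDirac (a : ℝ) : Measure ℝ :=
  if a = 0 then Measure.dirac 0 else gammaMeasure a 1

lemma gammaOrDirac_zero : gammaOrDirac 0 = Measure.dirac 0 := if_pos rfl

lemma gammaOrDirac_of_pos {a : ℝ} (ha : 0 < a) : gammaOrDirac a = gammaMeasure a 1 :=
  if_neg ha.ne'

lemma isProbabilityMeasure_gammaOrDirac {a : ℝ} (ha : 0 ≤ a) :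
    IsProbabilityMeasure (gammaOrDirac a) := by
  rcases ha.eq_or_lt with rfl | ha
  · rw [gammaOrDirac_zero]; infer_instance
  · rw [gammaOrDirac_of_pos ha]; exact isProbabilityMeasure_gammaMeasure ha one_pos

lemma ae_nonneg_gammaOrDirac {a : ℝ} (ha : 0 ≤ a) : ∀ᵐ x ∂gammaOrDirac a, 0 ≤ x := by
  rcases ha.eq_or_lt with rfl | ha
  · simp [gammaOrDirac_zero, ae_dirac_eq]
  · rw [gammaOrDirac_of_pos ha]
    exact (ae_pos_gammaMeasure a 1).mono fun _ => le_of_lt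

/-- For positive shapes, the two parts `θ t` and `t - θ t` of the Beta-Gamma splitting add up to
`t`. -/
lemma gammaOrDirac_conv {a b : ℝ} (ha : 0 ≤ a) (hb : 0 ≤ b) :
    gammaOrDirac a ∗ gammaOrDirac b = gammaOrDirac (a + b) := by
  have := isProbabilityMeasure_gammaOrDirac ha
  have := isProbabilityMeasure_gammaOrDirac hb
  rcases ha.eq_or_lt with rfl | ha
  · rw [gammaOrDirac_zero, Measure.dirac_zero_conv, zero_add]
  rcases hb.eq_or_lt with rfl | hb
  · rw [gammaOrDirac_zero, Measure.conv_dirac_zero, add_zero]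
  rw [gammaOrDirac_of_pos ha, gammaOrDirac_of_pos hb, gammaOrDirac_of_pos (add_pos ha hb),
    Measure.conv, ← map_betaMeasure_prod_gammaMeasure ha hb, Measure.map_map (by fun_prop)
    (by fun_prop)]
  have := isProbabilityMeasureBeta ha hb
  have := isProbabilityMeasure_gammaMeasure (add_pos ha hb) one_pos
  simp [Function.comp_def]

/-- The density is taken relative to the unscaled law and not to Lebesgue measure, so that the
degenerate shape `0` is covered: there it equals `1` at the only atom. -/
lemma gammaOrDirac_map_mul_left {a u : ℝ} (ha : 0 ≤ a) (hu : 0 < u) :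
    (gammaOrDirac a).map (fun x => u * x) = (gammaOrDirac a).withDensity
      fun x => ENNReal.ofReal (u ^ (-a) * Real.exp (x - u⁻¹ * x)) := by
  refine Measure.ext_of_lintegral _ fun f hf => ?_
  rw [lintegral_map hf (by fun_prop), lintegral_withDensity_eq_lintegral_mul _ (by fun_prop) hf]
  rcases ha.eq_or_lt with rfl | ha
  · simp [gammaOrDirac_zero, lintegral_dirac]
  rw [gammaOrDirac_of_pos ha, lintegral_gammaMeasure _ _ (by fun_prop),
    lintegral_gammaMeasure _ _ (by fun_prop)]
  conv_rhs => rw [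
    lintegral_eq_mul_lintegral_comp_mul_left hu.ne' (by fun_prop), abs_of_pos hu,
    ← lintegral_const_mul _ (by fun_prop)]
  refine lintegral_congr fun x => ?_
  simp only [Pi.mul_apply]
  rw [← mul_assoc, ← mul_assoc, gammaPDF, gammaPDF, ← ENNReal.ofReal_mul hu.le,
    ← ENNReal.ofReal_mul (mul_nonneg hu.le (gammaPDFReal_nonneg ha one_pos _))]
  congr 2
  rw [gammaPDFReal, gammaPDFReal]
  by_cases hx : 0 ≤ x
  · rw [if_pos hx, if_pos (by positivity), Real.mul_rpow hu.le hx, ← mul_assoc u⁻¹,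
      inv_mul_cancel₀ hu.ne', sub_eq_add_neg (u * x), Real.exp_add]
    have h1 : u * u ^ (a - 1) * u ^ (-a) = 1 := by
      rw [← Real.rpow_one_add' hu.le (by linarith), ← Real.rpow_add hu]; simp
    have h2 : Real.exp (-(1 * (u * x))) * Real.exp (u * x) = 1 := by
      rw [← Real.exp_add]; simp
    simp only [one_mul, Real.one_rpow] at h2 ⊢
    linear_combination (-(1 / Real.Gamma a * x ^ (a - 1) * Real.exp (-x))) *
      (Real.exp (-(u * x)) * Real.exp (u * x) * h1 + h2)
  · rw [if_neg hx, if_neg (fun h => hx (nonneg_of_mul_nonneg_right h hu))]; simp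

/-- Size biasing: the density of `Gamma (a + 1)` with respect to `Gamma a` is `x / a`. -/
lemma gammaMeasure_add_one {a : ℝ} (ha : 0 < a) :
    gammaMeasure (a + 1) 1 = (gammaMeasure a 1).withDensity fun x => ENNReal.ofReal (x / a) := by
  refine Measure.ext_of_lintegral _ fun f hf => ?_
  rw [lintegral_withDensity_eq_lintegral_mul _ (by fun_prop) hf,
    lintegral_gammaMeasure _ _ (by fun_prop), lintegral_gammaMeasure _ _ (by fun_prop)]
  refine lintegral_congr_ae ?_
  filter_upwards [Measure.ae_ne volume (0 : ℝ)] with x hx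
  simp only [Pi.mul_apply, gammaPDF]
  rw [← mul_assoc, ← ENNReal.ofReal_mul (gammaPDFReal_nonneg ha one_pos _)]
  congr 2
  rw [gammaPDFReal, gammaPDFReal]
  split_ifs with h
  · have h' := lt_of_le_of_ne h hx.symm
    have hG := Real.Gamma_pos_of_pos ha
    have : x ^ (a + 1 - 1) = x ^ (a - 1) * x := by
      rw [← Real.rpow_add_one h'.ne']; ring_nf
    rw [Real.Gamma_add_one ha.ne', this]
    simp only [Real.one_rpow]
    field_simp
  · simp

/-- The size-biased law has total mass `1`, which says that the mean is `a`. -/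
lemma lintegral_ofReal_gammaMeasure {a : ℝ} (ha : 0 < a) :
    ∫⁻ x, ENNReal.ofReal x ∂gammaMeasure a 1 = ENNReal.ofReal a := by
  have := isProbabilityMeasure_gammaMeasure (add_pos ha one_pos) one_pos
  have h := measure_univ (μ := gammaMeasure (a + 1) 1)
  rw [gammaMeasure_add_one ha, withDensity_apply _ .univ, Measure.restrict_univ] at h
  have h2 (x : ℝ) : ENNReal.ofReal x = ENNReal.ofReal a * ENNReal.ofReal (x / a) := by
    rw [← ENNReal.ofReal_mul ha.le, mul_div_cancel₀ _ ha.ne']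
  rw [lintegral_congr h2, lintegral_const_mul _ (by fun_prop), h, mul_one]

end Gamma

/-! ### Vectors of independent Gamma variables and their polar decomposition. -/

section GammaVector

open scoped ENNReal

variable {ι : Type*} [Fintype ι]

/-- On a box, the integral of a product of functions of independent coordinates factorises. -/
lemma pi_withDensity {E : ι → Type*} [∀ i, MeasurableSpace (E i)] (μ : ∀ i, Measure (E i))
    [∀ i, IsProbabilityMeasure (μ i)] {d : ∀ i, E i → ℝ≥0∞} (hd : ∀ i, Measurable (d i))
    [∀ i, SigmaFinite ((μ i).withDensity (d i))] :
    Measure.pi (fun i => (μ i).withDensity (d i)) =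
      (Measure.pi μ).withDensity fun z => ∏ i, d i (z i) := by
  classical
  refine Measure.pi_eq fun s hs => ?_
  rw [withDensity_apply _ (.univ_pi hs), ← lintegral_indicator (.univ_pi hs)]
  have h1 : (fun z : ∀ i, E i => (Set.univ.pi s).indicator (fun z => ∏ i, d i (z i)) z) =
      fun z => ∏ i, (s i).indicator (d i) (z i) := by
    funext z
    by_cases h : z ∈ Set.univ.pi s
    · rw [Set.indicator_of_mem h]
      exact Finset.prod_congr rfl fun i _ => (Set.indicator_of_mem (h i trivial) _).symm
    · rw [Set.indicator_of_notMem h]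
      simp only [Set.mem_pi, Set.mem_univ, true_imp_iff, not_forall] at h
      obtain ⟨i, hi⟩ := h
      exact (Finset.prod_eq_zero (Finset.mem_univ i) (Set.indicator_of_notMem hi _)).symm
  have hm (i : ι) : Measurable ((s i).indicator (d i)) := (hd i).indicator (hs i)
  rw [h1, lintegral_prod_eq_prod_lintegral_of_indepFun _ _
    (iIndepFun_pi fun i => (hm i).aemeasurable)
    (fun i => (hm i).comp (measurable_pi_apply i))]
  refine Finset.prod_congr rfl fun i _ => ?_
  rw [withDensity_apply _ (hs i), ← lintegral_indicator (hs i), ← lintegral_map (hm i) (by fun_prop),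
    (measurePreserving_eval μ i).map_eq]

/-- The law of a vector of independent Gamma variables with shapes `a i` and rate `1`. -/
noncomputable def gammaVector (a : ι → ℝ) : Measure (ι → ℝ) :=
  Measure.pi fun i => gammaOrDirac (a i)

lemma isProbabilityMeasure_gammaVector {a : ι → ℝ} (ha : ∀ i, 0 ≤ a i) :
    IsProbabilityMeasure (gammaVector a) := by
  have (i : ι) := isProbabilityMeasure_gammaOrDirac (ha i)
  unfold gammaVector
  infer_instance

lemma dirichletMeasure_eq_map (a : ι → ℝ) :
    dirichletMeasure a = (gammaVector a).map fun z i => z i / ∑ j, z j := rfl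

lemma ae_nonneg_gammaVector {a : ι → ℝ} (ha : ∀ i, 0 ≤ a i) :
    ∀ᵐ z ∂gammaVector a, ∀ i, 0 ≤ z i := by
  have (i : ι) := isProbabilityMeasure_gammaOrDirac (ha i)
  rw [ae_all_iff]
  intro i
  exact (Measure.quasiMeasurePreserving_eval (fun i => gammaOrDirac (a i)) i).ae
    (ae_nonneg_gammaOrDirac (ha i))

lemma ae_sum_pos_gammaVector {a : ι → ℝ} (ha : ∀ i, 0 ≤ a i) (ha' : 0 < ∑ i, a i) :
    ∀ᵐ z ∂gammaVector a, 0 < ∑ i, z i := by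
  have (i : ι) := isProbabilityMeasure_gammaOrDirac (ha i)
  obtain ⟨j, -, hj⟩ := Finset.exists_lt_of_sum_lt (s := Finset.univ) (f := fun _ : ι => (0 : ℝ))
    (g := a) (by simpa using ha')
  have h : ∀ᵐ z ∂gammaVector a, 0 < z j := by
    refine (Measure.quasiMeasurePreserving_eval (fun i => gammaOrDirac (a i)) j).ae
      (p := fun x => 0 < x) ?_
    rw [gammaOrDirac_of_pos hj]
    exact ae_pos_gammaMeasure _ _
  filter_upwards [h, ae_nonneg_gammaVector ha] with z hz hz'
  exact Finset.sum_pos' (fun i _ => hz' i) ⟨j, Finset.mem_univ j, hz⟩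

lemma gammaVector_conv {a b : ι → ℝ} (ha : ∀ i, 0 ≤ a i) (hb : ∀ i, 0 ≤ b i) :
    gammaVector a ∗ gammaVector b = gammaVector (a + b) := by
  have (i : ι) := isProbabilityMeasure_gammaOrDirac (ha i)
  have (i : ι) := isProbabilityMeasure_gammaOrDirac (hb i)
  have hconv (i : ι) : (((gammaOrDirac (a i)).prod (gammaOrDirac (b i))).map
      fun w => w.1 + w.2) = gammaOrDirac ((a + b) i) := gammaOrDirac_conv (ha i) (hb i)
  have (i : ι) : SigmaFinite (((gammaOrDirac (a i)).prod (gammaOrDirac (b i))).map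
      fun w => w.1 + w.2) := by
    have := Measure.isProbabilityMeasure_map
      (μ := (gammaOrDirac (a i)).prod (gammaOrDirac (b i))) (f := fun w => w.1 + w.2) (by fun_prop)
    infer_instance
  rw [Measure.conv, gammaVector, gammaVector,
    ← (measurePreserving_arrowProdEquivProdArrow ℝ ℝ ι _ _).map_eq,
    Measure.map_map (by fun_prop) (MeasurableEquiv.measurable _), gammaVector]
  simp_rw [← hconv]
  rw [← Measure.pi_map_pi (fun i => by fun_prop)]
  rfl

lemma gammaVector_map_smul {a : ι → ℝ} (ha : ∀ i, 0 ≤ a i) {u : ℝ} (hu : 0 < u) :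
    (gammaVector a).map (fun z => u • z) = (gammaVector a).withDensity fun z =>
      ENNReal.ofReal (u ^ (-∑ i, a i) * Real.exp (∑ i, z i - u⁻¹ * ∑ i, z i)) := by
  have (i : ι) := isProbabilityMeasure_gammaOrDirac (ha i)
  have h (i : ι) : IsProbabilityMeasure ((gammaOrDirac (a i)).map fun x => u * x) :=
    Measure.isProbabilityMeasure_map (by fun_prop)
  have h' (i : ι) : SigmaFinite ((gammaOrDirac (a i)).withDensity
      fun x => ENNReal.ofReal (u ^ (-a i) * Real.exp (x - u⁻¹ * x))) := by
    rw [← gammaOrDirac_map_mul_left (ha i) hu]; infer_instance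
  have e : (fun z : ι → ℝ => u • z) = fun z i => u * z i := rfl
  rw [gammaVector, e, Measure.pi_map_pi (fun i => by fun_prop)]
  simp_rw [fun i => gammaOrDirac_map_mul_left (ha i) hu]
  rw [pi_withDensity _ (fun i => by fun_prop)]
  congr 1
  funext z
  rw [← ENNReal.ofReal_prod_of_nonneg (fun i _ => by positivity), Finset.prod_mul_distrib,
    ← Real.exp_sum, Finset.sum_sub_distrib, Finset.mul_sum, ← Finset.sum_neg_distrib,
    Real.rpow_sum_of_pos hu]

/-- The law of the total of the components is recovered by an independent Gamma radius: if
`t ∼ Gamma (∑ i, a i)` and `d ∼ Dirichlet a` are independent, then `t • d` has independent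
components `Gamma (a i)`. -/
lemma map_gammaMeasure_prod_dirichletMeasure {a : ι → ℝ} (ha : ∀ i, 0 ≤ a i)
    (ha' : 0 < ∑ i, a i) :
    ((gammaMeasure (∑ i, a i) 1).prod (dirichletMeasure a)).map (fun w => w.1 • w.2) =
      gammaVector a := by
  have := isProbabilityMeasure_gammaVector ha
  have := isProbabilityMeasure_dirichletMeasure ha
  have := isProbabilityMeasure_gammaMeasure ha' one_pos
  set A := ∑ i, a i with hA
  -- The density of `1 / t` for `t ∼ Gamma A`; that its integral is `1` is deduced at the end, not
  -- computed.
  set g : ℝ → ℝ := fun u => if 0 < u then u⁻¹ * u ^ (-A) * Real.exp (-u⁻¹) / Real.Gamma A else 0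
    with hg
  have hgm : Measurable g := Measurable.ite measurableSet_Ioi (by fun_prop) (by fun_prop)
  -- The claim up to the constant `∫ g`. With `s` the sum of `z`, substitute `t = s u`, so that `t •
  -- (z / s) = u • z`; for fixed `u`, absorb the scaling into a density against `gammaVector a`;
  -- finally replace `u` by `s u`, after which the weight no longer depends on `z`.
  have key (f : (ι → ℝ) → ℝ≥0∞) (hf : Measurable f) :
      ∫⁻ w, f w ∂((gammaMeasure A 1).prod (dirichletMeasure a)).map (fun w => w.1 • w.2) =
        (∫⁻ w, f w ∂gammaVector a) * ∫⁻ u, ENNReal.ofReal (g u) := by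
    rw [lintegral_map hf (by fun_prop), lintegral_prod_symm _ (by fun_prop),
      dirichletMeasure_eq_map, lintegral_map (by fun_prop) (by fun_prop)]
    have h1 : ∀ᵐ z ∂gammaVector a,
        ∫⁻ t, f (t • fun i => z i / ∑ j, z j) ∂gammaMeasure A 1 =
          ∫⁻ u, ENNReal.ofReal (∑ j, z j) * (gammaPDF A 1 ((∑ j, z j) * u) * f (u • z)) := by
      filter_upwards [ae_sum_pos_gammaVector ha ha'] with z hz
      rw [lintegral_gammaMeasure _ _ (by fun_prop),
        lintegral_eq_mul_lintegral_comp_mul_left hz.ne' (by fun_prop), abs_of_pos hz,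
        lintegral_const_mul _ (by fun_prop)]
      congr 1
      refine lintegral_congr fun u => ?_
      congr 2
      ext i
      simp only [Pi.smul_apply, smul_eq_mul]
      field_simp
    rw [lintegral_congr_ae h1, lintegral_lintegral_swap (by fun_prop)]
    have h2 : ∀ᵐ u : ℝ, ∫⁻ z, ENNReal.ofReal (∑ j, z j) *
        (gammaPDF A 1 ((∑ j, z j) * u) * f (u • z)) ∂gammaVector a =
        ∫⁻ z, f z * ENNReal.ofReal (if 0 < u then (∑ j, z j) ^ A / Real.Gamma A * u⁻¹ *
          u ^ (-A) * Real.exp (- ((∑ j, z j) * u⁻¹)) else 0) ∂gammaVector a := by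
      filter_upwards [Measure.ae_ne volume (0 : ℝ)] with u hu
      rcases lt_or_gt_of_ne hu with hu | hu
      · simp only [if_neg hu.not_gt]
        refine lintegral_congr_ae ?_
        filter_upwards [ae_sum_pos_gammaVector ha ha'] with z hz
        rw [gammaPDF_of_neg (mul_neg_of_pos_of_neg hz hu)]
        simp
      · have h3 (z : ι → ℝ) : ENNReal.ofReal (∑ j, z j) *
            (gammaPDF A 1 ((∑ j, z j) * u) * f (u • z)) =
            (fun w : ι → ℝ => ENNReal.ofReal (u⁻¹ * ∑ j, w j) *
            (gammaPDF A 1 (∑ j, w j) * f w)) (u • z) := by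
          simp only [Pi.smul_apply, smul_eq_mul, ← Finset.mul_sum]
          rw [inv_mul_cancel_left₀ hu.ne', mul_comm u]
        simp_rw [h3]
        rw [← lintegral_map (f := fun w : ι → ℝ => ENNReal.ofReal (u⁻¹ * ∑ j, w j) *
            (gammaPDF A 1 (∑ j, w j) * f w)) (by fun_prop) (by fun_prop),
          gammaVector_map_smul ha hu, lintegral_withDensity_eq_lintegral_mul _ (by fun_prop)
          (by fun_prop)]
        refine lintegral_congr_ae ?_
        filter_upwards [ae_sum_pos_gammaVector ha ha'] with z hz
        simp only [Pi.mul_apply, gammaPDF, gammaPDFReal, if_pos hz.le, if_pos hu]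
        set s := ∑ j, z j
        have e1 : s ^ (A - 1) * s = s ^ A := by rw [← Real.rpow_add_one hz.ne']; ring_nf
        have e2 : Real.exp (-(1 * s)) * Real.exp (s - u⁻¹ * s) = Real.exp (-(s * u⁻¹)) := by
          rw [← Real.exp_add]; ring_nf
        have hG := Real.Gamma_pos_of_pos ha'
        have e3 : s ^ A / Real.Gamma A * u⁻¹ * u ^ (-A) * Real.exp (-(s * u⁻¹)) =
            (u ^ (-A) * Real.exp (s - u⁻¹ * s)) * (u⁻¹ * s) *
              (1 ^ A / Real.Gamma A * s ^ (A - 1) * Real.exp (-(1 * s))) := by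
          rw [← e1, ← e2, Real.one_rpow]
          ring
        rw [e3, ← hA, ENNReal.ofReal_mul (p := _ * (u⁻¹ * s)) (by positivity),
          ENNReal.ofReal_mul (p := u ^ (-A) * Real.exp (s - u⁻¹ * s)) (by positivity)]
        ac_rfl
    rw [lintegral_congr_ae h2, lintegral_lintegral_swap (by
      have : Measurable fun w : ℝ × (ι → ℝ) => if 0 < w.1 then (∑ j, w.2 j) ^ A / Real.Gamma A *
          w.1⁻¹ * w.1 ^ (-A) * Real.exp (- ((∑ j, w.2 j) * w.1⁻¹)) else 0 :=
        Measurable.ite (measurableSet_lt (by fun_prop) (by fun_prop)) (by fun_prop) (by fun_prop)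
      exact (Measurable.mul (by fun_prop) (by fun_prop)).aemeasurable),
      ← lintegral_mul_const _ hf]
    refine lintegral_congr_ae ?_
    filter_upwards [ae_sum_pos_gammaVector ha ha'] with z hz
    have hm : Measurable fun u : ℝ => if 0 < u then (∑ j, z j) ^ A / Real.Gamma A *
          u⁻¹ * u ^ (-A) * Real.exp (- ((∑ j, z j) * u⁻¹)) else 0 :=
        Measurable.ite measurableSet_Ioi (by fun_prop) (by fun_prop)
    rw [lintegral_const_mul _ (by fun_prop),
      lintegral_eq_mul_lintegral_comp_mul_left hz.ne' (by fun_prop), abs_of_pos hz,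
      ← lintegral_const_mul' _ _ ENNReal.ofReal_ne_top]
    congr 1
    refine lintegral_congr fun u => ?_
    rw [← ENNReal.ofReal_mul hz.le]
    congr 1
    set s := ∑ j, z j
    simp only [hg]
    by_cases hu : 0 < u
    · rw [if_pos hu, if_pos (by positivity), Real.mul_rpow hz.le hu.le, mul_inv,
        mul_inv_cancel_left₀ hz.ne']
      have e1 : s ^ A * s ^ (-A) = 1 := by rw [← Real.rpow_add hz]; simp
      have e2 : s * s⁻¹ = 1 := mul_inv_cancel₀ hz.ne'
      linear_combination (u⁻¹ * u ^ (-A) * Real.exp (-u⁻¹) / Real.Gamma A) *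
        (s * s⁻¹ * e1 + e2)
    · rw [if_neg hu, if_neg (by simpa [hz] using hu), mul_zero]
  -- Testing `key` on the constant `1` compares the masses of two probability measures.
  have hone : ∫⁻ u, ENNReal.ofReal (g u) = 1 := by
    have h := key (fun _ => 1) measurable_const
    have := Measure.isProbabilityMeasure_map (μ := (gammaMeasure A 1).prod (dirichletMeasure a))
      (f := fun w => w.1 • w.2) (by fun_prop)
    simpa using h.symm
  refine Measure.ext_of_lintegral _ fun f hf => ?_
  rw [key f hf, hone, mul_one]

end GammaVector

/-! ### Dirichlet vectors: aggregation, one conditional step, size biasing. -/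

section Dirichlet

open scoped ENNReal

variable {ι κ : Type*} [Fintype ι] [DecidableEq κ]

lemma ae_mem_stdSimplex_dirichletMeasure {a : ι → ℝ} (ha : ∀ i, 0 ≤ a i) (ha' : 0 < ∑ i, a i) :
    ∀ᵐ d ∂dirichletMeasure a, d ∈ stdSimplex ℝ ι := by
  rw [dirichletMeasure_eq_map]
  refine (ae_map_iff (by fun_prop) (isClosed_stdSimplex ℝ ι).measurableSet).2 ?_
  filter_upwards [ae_nonneg_gammaVector ha, ae_sum_pos_gammaVector ha ha'] with z hz hs
  exact ⟨fun i => div_nonneg (hz i) hs.le, by rw [← Finset.sum_div, div_self hs.ne']⟩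

/-- The vector of sums of `z` over the fibres of `c`. -/
def fiberSum (c : ι → κ) (z : ι → ℝ) : κ → ℝ := fun j => ∑ i with c i = j, z i

@[fun_prop]
lemma measurable_fiberSum (c : ι → κ) : Measurable (fiberSum c) := by
  unfold fiberSum; fun_prop

lemma fiberSum_smul (c : ι → κ) (t : ℝ) (z : ι → ℝ) : fiberSum c (t • z) = t • fiberSum c z := by
  ext j; simp [fiberSum, Finset.mul_sum]

lemma sum_fiberSum [Fintype κ] (c : ι → κ) (z : ι → ℝ) : ∑ j, fiberSum c z j = ∑ i, z i :=
  Finset.sum_fiberwise _ _ _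

lemma fiberSum_nonneg (c : ι → κ) {z : ι → ℝ} (hz : ∀ i, 0 ≤ z i) (j : κ) : 0 ≤ fiberSum c z j :=
  Finset.sum_nonneg fun i _ => hz i

lemma fiberSum_succ {n : ℕ} (c : Fin (n + 1) → κ) (z : Fin (n + 1) → ℝ) :
    fiberSum c z = Pi.single (c 0) (z 0) + fiberSum (fun i : Fin n => c i.succ) (fun i : Fin n => z i.succ) := by
  ext j
  simp only [fiberSum, Finset.sum_filter, Fin.sum_univ_succ, Pi.add_apply, Pi.single_apply,
    eq_comm (a := j)]

lemma fiberSum_snoc {n : ℕ} (c : Fin n → κ) (z : Fin n → ℝ) (k : κ) (x : ℝ) :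
    fiberSum (Fin.snoc (α := fun _ => κ) c k) (Fin.snoc (α := fun _ => ℝ) z x) =
      fiberSum c z + Pi.single k x := by
  ext j
  simp [fiberSum, Finset.sum_filter, Fin.sum_univ_castSucc, Pi.single_apply, eq_comm (a := j)]

variable [Fintype κ]

/-- Coordinates with shape `0` are identically `0`, so a single Gamma variable placed in coordinate
`j` is itself a Gamma vector. -/
lemma gammaOrDirac_map_single {a : ℝ} (ha : 0 ≤ a) (j : κ) :
    (gammaOrDirac a).map (Pi.single j) = gammaVector (Pi.single j a : κ → ℝ) := by
  have := isProbabilityMeasure_gammaOrDirac ha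
  have hs (i : κ) : 0 ≤ (Pi.single j a : κ → ℝ) i := by
    by_cases h : i = j
    · subst h; simpa
    · simp [h]
  have (i : κ) := isProbabilityMeasure_gammaOrDirac (hs i)
  have hm : Measurable (Pi.single (M := fun _ : κ => ℝ) j) := measurable_update 0
  refine (Measure.pi_eq fun s hs => ?_).symm
  rw [Measure.map_apply hm (.univ_pi hs), ← Finset.mul_prod_erase _ _ (Finset.mem_univ j),
    Pi.single_eq_same]
  have h1 : ∀ i ∈ Finset.univ.erase j, gammaOrDirac ((Pi.single j a : κ → ℝ) i) (s i) =
      (s i).indicator 1 0 := by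
    intro i hi
    rw [Pi.single_eq_of_ne (Finset.ne_of_mem_erase hi), gammaOrDirac_zero,
      Measure.dirac_apply' _ (hs i)]
  rw [Finset.prod_congr rfl h1]
  by_cases h : ∀ i ∈ Finset.univ.erase j, (0 : ℝ) ∈ s i
  · rw [Finset.prod_eq_one fun i hi => Set.indicator_of_mem (h i hi) _, mul_one]
    congr 1
    ext x
    simp only [Set.mem_preimage, Set.mem_pi, Set.mem_univ, true_imp_iff]
    refine ⟨fun hx => by simpa using hx j, fun hx i => ?_⟩
    by_cases hij : i = j
    · subst hij; simpa
    · simpa [hij] using h i (by simp [hij])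
  · push Not at h
    obtain ⟨i, hi, hi'⟩ := h
    rw [Finset.prod_eq_zero hi (Set.indicator_of_notMem hi' _), mul_zero]
    convert measure_empty (μ := gammaOrDirac a)
    ext x
    simp only [Set.mem_preimage, Set.mem_pi, Set.mem_univ, true_imp_iff, Set.mem_empty_iff_false,
      iff_false, not_forall]
    exact ⟨i, by simpa [Finset.ne_of_mem_erase hi] using hi'⟩

/-- Aggregation: sums of independent Gamma variables over disjoint groups are independent Gamma
variables. Coordinates are peeled off one by one and recombined by convolution. -/
lemma gammaVector_map_fiberSum {n : ℕ} (c : Fin n → κ) {a : Fin n → ℝ} (ha : ∀ i, 0 ≤ a i) :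
    (gammaVector a).map (fiberSum c) = gammaVector (fiberSum c a) := by
  induction n with
  | zero =>
    have h0 : gammaVector (fiberSum c a) = Measure.dirac 0 := by
      have : fiberSum c a = 0 := by ext j; simp [fiberSum]
      simp only [this, gammaVector, Pi.zero_apply, gammaOrDirac_zero]
      refine Measure.pi_eq fun s hs => ?_
      rw [Measure.dirac_apply' _ (.univ_pi hs)]
      simp only [Measure.dirac_apply' _ (hs _)]
      by_cases h : ∀ i, (0 : ℝ) ∈ s i
      · simp [h]
      · push Not at h
        obtain ⟨i, hi⟩ := h
        rw [Set.indicator_of_notMem (fun h : _ ∈ Set.univ.pi s => hi (h i trivial)),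
          Finset.prod_eq_zero (Finset.mem_univ i) (Set.indicator_of_notMem hi _)]
    have h1 : fiberSum c = fun _ => 0 := by ext z j; simp [fiberSum]
    have := isProbabilityMeasure_gammaVector ha
    rw [h0, h1, Measure.map_const, measure_univ, one_smul]
  | succ n ih =>
    have (i : Fin (n + 1)) := isProbabilityMeasure_gammaOrDirac (ha i)
    have := isProbabilityMeasure_gammaVector fun i : Fin n => ha i.succ
    have hs (i : κ) : 0 ≤ (Pi.single (c 0) (a 0) : κ → ℝ) i := by
      by_cases h : i = c 0
      · subst h; simpa using ha 0
      · simp [h]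
    have := isProbabilityMeasure_gammaVector hs
    have hm : Measurable (Pi.single (M := fun _ : κ => ℝ) (c 0)) := measurable_update 0
    have e := (measurePreserving_piFinSuccAbove (fun i => gammaOrDirac (a i)) 0).symm.map_eq
    rw [fiberSum_succ, ← gammaVector_conv hs (fiberSum_nonneg _ fun i : Fin n => ha i.succ), ← ih _
      (fun i : Fin n => ha i.succ), ← gammaOrDirac_map_single (ha 0), gammaVector, ← e,
      Measure.map_map (by fun_prop) (MeasurableEquiv.measurable _), Measure.conv,
      Measure.map_prod_map _ _ hm (by fun_prop), Measure.map_map (by fun_prop)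
      (by fun_prop)]
    congr 1
    funext w
    simp [fiberSum_succ]

lemma sum_add_fiberSum_one {n : ℕ} {a : κ → ℝ} (c : Fin n → κ) :
    ∑ j, (a + fiberSum c 1) j = ∑ j, a j + n := by
  simp only [Pi.add_apply]
  rw [Finset.sum_add_distrib, sum_fiberSum]; simp

/-- Conditionally on the atoms `c`, one step of the recursion started from a Dirichlet vector
produces a Dirichlet vector with the counts of the atoms added to the parameter. -/
lemma map_betaMeasure_prod_dirichletMeasure {n : ℕ} (hn : 1 ≤ n) {a : κ → ℝ} (ha : ∀ j, 0 ≤ a j)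
    (ha' : 0 < ∑ j, a j) (c : Fin n → κ) :
    ((betaMeasure n (∑ j, a j)).prod ((dirichletMeasure fun _ : Fin n => 1).prod
      (dirichletMeasure a))).map
      (fun w => w.1 • fiberSum c w.2.1 + (1 - w.1) • w.2.2) =
      dirichletMeasure (a + fiberSum c 1) := by
  rw [show (1 : Fin n → ℝ) = fun _ => 1 from rfl]
  have hn' : (0 : ℝ) < n := by exact_mod_cast hn
  have h1 : ∀ i : Fin n, (0 : ℝ) ≤ (fun _ => 1) i := fun _ => zero_le_one
  have hs : ∑ _i : Fin n, (1 : ℝ) = n := by simp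
  have hs1 : 0 < ∑ _i : Fin n, (1 : ℝ) := by rw [hs]; exact hn'
  have hc := fiberSum_nonneg c h1
  set A := ∑ j, a j
  have := isProbabilityMeasureBeta hn' ha'
  have := isProbabilityMeasure_gammaMeasure (add_pos hn' ha') one_pos
  have := isProbabilityMeasure_gammaMeasure hn' one_pos
  have := isProbabilityMeasure_gammaMeasure ha' one_pos
  have := isProbabilityMeasure_dirichletMeasure h1
  have := isProbabilityMeasure_dirichletMeasure ha
  have := isProbabilityMeasure_gammaVector h1
  have := isProbabilityMeasure_gammaVector ha
  have := isProbabilityMeasure_gammaVector hc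
  refine Measure.ext_of_lintegral _ fun f hf => ?_
  rw [lintegral_map hf (by fun_prop), dirichletMeasure_eq_map (a + fiberSum c _),
    lintegral_map hf (by fun_prop)]
  set F : (κ → ℝ) → ℝ≥0∞ := fun z => f fun i => z i / ∑ j, z j with hF
  have hFm : Measurable F := by fun_prop
  -- The normalisation in `F` cancels any positive radius, so an independent `t ∼ Gamma (n + A)` can
  -- be inserted; the coordinates then sum to `t` because both Dirichlet vectors lie in their
  -- simplices.
  have hL : ∫⁻ w, f (w.1 • fiberSum c w.2.1 + (1 - w.1) • w.2.2) ∂(betaMeasure n A).prod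
      ((dirichletMeasure fun _ : Fin n => 1).prod (dirichletMeasure a)) =
      ∫⁻ w, ∫⁻ t, F ((w.1 * t) • fiberSum c w.2.1 + (t - w.1 * t) • w.2.2)
        ∂gammaMeasure (n + A) 1 ∂(betaMeasure n A).prod
      ((dirichletMeasure fun _ : Fin n => 1).prod (dirichletMeasure a)) := by
    have hd : ∀ᵐ v ∂(dirichletMeasure fun _ : Fin n => 1).prod (dirichletMeasure a),
        v.1 ∈ stdSimplex ℝ (Fin n) ∧ v.2 ∈ stdSimplex ℝ κ :=
      (Measure.quasiMeasurePreserving_fst.ae (ae_mem_stdSimplex_dirichletMeasure h1 hs1)).and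
        (Measure.quasiMeasurePreserving_snd.ae (ae_mem_stdSimplex_dirichletMeasure ha ha'))
    refine lintegral_congr_ae ?_
    filter_upwards [Measure.quasiMeasurePreserving_snd.ae hd] with w hw
    have : ∀ᵐ t ∂gammaMeasure (n + A) 1,
        F ((w.1 * t) • fiberSum c w.2.1 + (t - w.1 * t) • w.2.2) =
          f (w.1 • fiberSum c w.2.1 + (1 - w.1) • w.2.2) := by
      filter_upwards [ae_pos_gammaMeasure (n + A) 1] with t ht
      have e : ∑ j, ((w.1 * t) • fiberSum c w.2.1 + (t - w.1 * t) • w.2.2) j = t := by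
        simp only [Pi.add_apply, Pi.smul_apply, smul_eq_mul, Finset.sum_add_distrib,
          ← Finset.mul_sum, sum_fiberSum, hw.1.2, hw.2.2]
        ring
      simp only [hF, e]
      congr 1
      ext j
      simp only [Pi.add_apply, Pi.smul_apply, smul_eq_mul]
      field_simp
    rw [lintegral_congr_ae this]
    simp
  rw [hL, lintegral_prod_symm _ (by fun_prop)]
  -- The Beta weight splits the radius into independent radii `Gamma n` and `Gamma A`, the right
  -- ones for the two Dirichlet vectors.
  have hbg (v : (Fin n → ℝ) × (κ → ℝ)) :
      ∫⁻ θ, ∫⁻ t, F ((θ * t) • fiberSum c v.1 + (t - θ * t) • v.2) ∂gammaMeasure (n + A) 1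
        ∂betaMeasure n A =
      ∫⁻ g, ∫⁻ s, F (g • fiberSum c v.1 + s • v.2) ∂gammaMeasure A 1 ∂gammaMeasure n 1 := by
    rw [← lintegral_prod (fun w : ℝ × ℝ => F ((w.1 * w.2) • fiberSum c v.1 +
        (w.2 - w.1 * w.2) • v.2)) (by fun_prop),
      ← lintegral_prod (fun w : ℝ × ℝ => F (w.1 • fiberSum c v.1 + w.2 • v.2)) (by fun_prop),
      ← map_betaMeasure_prod_gammaMeasure hn' ha', lintegral_map (by fun_prop) (by fun_prop)]
  simp_rw [hbg]
  rw [lintegral_prod _ (by fun_prop)]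
  have hGa : ∀ x : κ → ℝ, ∫⁻ d, ∫⁻ s, F (x + s • d) ∂gammaMeasure A 1 ∂dirichletMeasure a =
      ∫⁻ z, F (x + z) ∂gammaVector a := by
    intro x
    rw [← map_gammaMeasure_prod_dirichletMeasure ha ha', lintegral_map (by fun_prop) (by fun_prop),
      lintegral_prod_symm _ (by fun_prop)]
  have hswap (q : Fin n → ℝ) :
      ∫⁻ d, ∫⁻ g, ∫⁻ s, F (g • fiberSum c q + s • d) ∂gammaMeasure A 1 ∂gammaMeasure n 1
        ∂dirichletMeasure a =
      ∫⁻ g, ∫⁻ z, F (fiberSum c (g • q) + z) ∂gammaVector a ∂gammaMeasure n 1 := by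
    rw [lintegral_lintegral_swap (by fun_prop)]
    simp_rw [hGa, fiberSum_smul]
  simp_rw [hswap]
  have hGn : ((gammaMeasure n 1).prod (dirichletMeasure fun _ : Fin n => 1)).map
      (fun w => w.1 • w.2) = gammaVector fun _ : Fin n => (1 : ℝ) := by
    have := map_gammaMeasure_prod_dirichletMeasure h1 hs1
    rwa [hs] at this
  rw [← lintegral_prod_symm (fun w : ℝ × (Fin n → ℝ) =>
      ∫⁻ z, F (fiberSum c (w.1 • w.2) + z) ∂gammaVector a) (by fun_prop),
    ← lintegral_map (f := fun x : Fin n → ℝ => ∫⁻ z, F (fiberSum c x + z) ∂gammaVector a)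
      (by fun_prop) (by fun_prop), hGn,
    ← lintegral_map (f := fun x : κ → ℝ => ∫⁻ z, F (x + z) ∂gammaVector a)
      (by fun_prop) (by fun_prop), gammaVector_map_fiberSum c h1, add_comm a,
    ← gammaVector_conv (fiberSum_nonneg c h1) ha, Measure.lintegral_conv hFm]

/-- Size biasing by coordinate `j` raises its shape by one. If `a j = 0` the coordinate vanishes
almost surely and both sides are `0`. -/
lemma ofReal_mul_lintegral_gammaVector_add_single {a : κ → ℝ} (ha : ∀ j, 0 ≤ a j) (j : κ)
    {f : (κ → ℝ) → ℝ≥0∞} (hf : Measurable f) :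
    ENNReal.ofReal (a j) * ∫⁻ z, f z ∂gammaVector (a + Pi.single j 1) =
      ∫⁻ z, ENNReal.ofReal (z j) * f z ∂gammaVector a := by
  have (i : κ) := isProbabilityMeasure_gammaOrDirac (ha i)
  rcases (ha j).eq_or_lt with h0 | hj
  · rw [← h0, ENNReal.ofReal_zero, zero_mul]
    have : ∀ᵐ z ∂gammaVector a, z j = 0 := by
      refine (Measure.quasiMeasurePreserving_eval (fun i => gammaOrDirac (a i)) j).ae
        (p := fun x => x = 0) ?_
      rw [← h0, gammaOrDirac_zero, ae_dirac_eq]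
      rfl
    rw [lintegral_congr_ae (g := 0) (this.mono fun z hz => by simp [hz])]
    simp
  · have hd (i : κ) : gammaOrDirac ((a + Pi.single j 1 : κ → ℝ) i) = (gammaOrDirac (a i)).withDensity
        fun x => if i = j then ENNReal.ofReal (x / a j) else 1 := by
      by_cases hij : i = j
      · subst hij
        simp only [Pi.add_apply, Pi.single_eq_same, if_true]
        rw [gammaOrDirac_of_pos (by linarith), gammaOrDirac_of_pos hj, gammaMeasure_add_one hj]
      · simp only [Pi.add_apply, Pi.single_eq_of_ne hij, add_zero, if_neg hij]
        exact withDensity_one.symm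
    have hp (i : κ) : 0 ≤ (a + Pi.single j 1 : κ → ℝ) i :=
      add_nonneg (ha i) (by by_cases h : i = j <;> simp [h])
    have (i : κ) : SigmaFinite ((gammaOrDirac (a i)).withDensity
        fun x => if i = j then ENNReal.ofReal (x / a j) else 1) := by
      rw [← hd]
      have := isProbabilityMeasure_gammaOrDirac (hp i)
      infer_instance
    have hm (i : κ) : Measurable fun x : ℝ => if i = j then ENNReal.ofReal (x / a j) else 1 := by
      split_ifs <;> fun_prop
    have hmm : Measurable fun z : κ → ℝ =>
        ∏ i, if i = j then ENNReal.ofReal (z i / a j) else 1 :=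
      Finset.measurable_fun_prod _ fun i _ => (hm i).comp (measurable_pi_apply i)
    rw [gammaVector, funext hd, pi_withDensity _ hm, lintegral_withDensity_eq_lintegral_mul _ hmm hf,
      ← lintegral_const_mul' _ _ ENNReal.ofReal_ne_top]
    refine lintegral_congr fun z => ?_
    simp only [Pi.mul_apply, Finset.prod_ite_eq', Finset.mem_univ, if_true]
    rw [← mul_assoc, ← ENNReal.ofReal_mul hj.le, mul_div_cancel₀ _ hj.ne']

/-- A Dirichlet distribution is the mixture of its one-step posteriors. -/
lemma sum_mul_lintegral_dirichletMeasure_add_single {a : κ → ℝ} (ha : ∀ j, 0 ≤ a j)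
    (ha' : 0 < ∑ j, a j) {f : (κ → ℝ) → ℝ≥0∞} (hf : Measurable f) :
    ∑ j, ENNReal.ofReal (a j) * ∫⁻ d, f d ∂dirichletMeasure (a + Pi.single j 1) =
      ENNReal.ofReal (∑ j, a j) * ∫⁻ d, f d ∂dirichletMeasure a := by
  have := isProbabilityMeasure_gammaMeasure ha' one_pos
  have := isProbabilityMeasure_dirichletMeasure ha
  have h1 (j : κ) : ENNReal.ofReal (a j) * ∫⁻ d, f d ∂dirichletMeasure (a + Pi.single j 1) =
      ∫⁻ z, ENNReal.ofReal (z j) * f (fun i => z i / ∑ k, z k) ∂gammaVector a := by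
    rw [dirichletMeasure_eq_map, lintegral_map hf (by fun_prop),
      ofReal_mul_lintegral_gammaVector_add_single ha j (by fun_prop)]
  simp_rw [h1]
  -- The size-biasing weights add up to the total `∑ j, z j`, which is the radius: it is independent
  -- of the direction and has mean `∑ j, a j`.
  rw [← lintegral_finsetSum _ (fun j _ => by fun_prop),
    ← map_gammaMeasure_prod_dirichletMeasure ha ha', lintegral_map (by fun_prop) (by fun_prop),
    ← lintegral_ofReal_gammaMeasure ha', ← lintegral_prod_mul (by fun_prop) (by fun_prop)]
  refine lintegral_congr_ae ?_
  filter_upwards [Measure.quasiMeasurePreserving_fst.ae (ae_pos_gammaMeasure _ _),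
    Measure.quasiMeasurePreserving_snd.ae (ae_mem_stdSimplex_dirichletMeasure ha ha')] with w ht hd
  have e : ∑ k, (w.1 • w.2) k = w.1 := by
    simp only [Pi.smul_apply, smul_eq_mul, ← Finset.mul_sum, hd.2, mul_one]
  rw [← Finset.sum_mul, ← ENNReal.ofReal_sum_of_nonneg
    (f := w.1 • w.2) (fun i _ => mul_nonneg ht.le (hd.1 i)), e]
  congr 2
  ext i
  simp only [Pi.smul_apply, smul_eq_mul]
  field_simp

end Dirichlet

/-! ### Pólya sequences and stationarity of the Dirichlet law for cell masses. -/

section Polya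

open scoped ENNReal

variable {X : Type*} [MeasurableSpace X]

lemma isMarkovKernel_polyaPredictive (α : Measure X) [IsFiniteMeasure α] (hα : α ≠ 0) (j : ℕ) :
    IsMarkovKernel (polyaPredictive α j) := by
  refine ⟨fun y => ⟨?_⟩⟩
  have h0 : α Set.univ ≠ 0 := by simpa using hα
  change ((α Set.univ + j)⁻¹ • (α + ∑ i, Measure.dirac (y i))) Set.univ = 1
  simp only [Measure.smul_apply, Measure.add_apply, Measure.finsetSum_apply, measure_univ,
    Finset.sum_const, Finset.card_univ, Fintype.card_fin, smul_eq_mul, nsmul_eq_mul, mul_one]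
  exact ENNReal.inv_mul_cancel (by simp [h0]) (by finiteness)

lemma measurable_snoc {n : ℕ} :
    Measurable fun p : (Fin n → X) × X => (Fin.snoc p.1 p.2 : Fin (n + 1) → X) := by
  refine measurable_pi_lambda _ fun i => Fin.lastCases ?_ (fun i => ?_) i
  · simpa using measurable_snd
  · simpa [Function.comp_def] using (measurable_pi_apply i).comp measurable_fst

lemma isProbabilityMeasure_polyaLaw (α : Measure X) [IsFiniteMeasure α] (hα : α ≠ 0) (n : ℕ) :
    IsProbabilityMeasure (polyaLaw α n) := by
  induction n with
  | zero => unfold polyaLaw; infer_instance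
  | succ n ih =>
    have := isMarkovKernel_polyaPredictive α hα n
    unfold polyaLaw
    exact Measure.isProbabilityMeasure_map measurable_snoc.aemeasurable

lemma isProbabilityMeasure_innovationLaw (α : Measure X) [IsFiniteMeasure α] (hα : α ≠ 0) {n : ℕ}
    (hn : 1 ≤ n) : IsProbabilityMeasure (innovationLaw α n) := by
  have := isProbabilityMeasure_polyaLaw α hα n
  have := isProbabilityMeasure_dirichletMeasure (a := fun _ : Fin n => 1) fun _ => zero_le_one
  have := isProbabilityMeasureBeta (α := n) (β := α.real Set.univ) (by exact_mod_cast hn)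
    (by have : NeZero α := ⟨hα⟩; exact measureReal_univ_pos)
  unfold innovationLaw
  infer_instance

lemma ae_innovationLaw (α : Measure X) [IsFiniteMeasure α] (hα : α ≠ 0) {n : ℕ} (hn : 1 ≤ n) :
    ∀ᵐ z ∂innovationLaw α n, z.1 ∈ Set.Ioo (0 : ℝ) 1 ∧ z.2.1 ∈ stdSimplex ℝ (Fin n) := by
  have := isProbabilityMeasure_polyaLaw α hα n
  have := isProbabilityMeasure_dirichletMeasure (a := fun _ : Fin n => 1) fun _ => zero_le_one
  have hb : 0 < α.real Set.univ := by have : NeZero α := ⟨hα⟩; exact measureReal_univ_pos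
  have := isProbabilityMeasureBeta (α := n) (β := α.real Set.univ) (by exact_mod_cast hn) hb
  unfold innovationLaw
  refine (Measure.quasiMeasurePreserving_fst.ae (ae_mem_Ioo_betaMeasure _ _)).and
    (Measure.quasiMeasurePreserving_snd.ae (Measure.quasiMeasurePreserving_fst.ae
    (ae_mem_stdSimplex_dirichletMeasure (fun _ => zero_le_one) ?_)))
  simp
  omega

variable {κ : Type*}

/-- The parameters of the Dirichlet law of the cell probabilities, when `c` maps each point to
(the index of) its cell. -/
noncomputable def cellMass (α : Measure X) (c : X → κ) : κ → ℝ := fun j => α.real (c ⁻¹' {j})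

lemma cellMass_nonneg (α : Measure X) (c : X → κ) (j : κ) : 0 ≤ cellMass α c j :=
  measureReal_nonneg

variable [Fintype κ] [MeasurableSpace κ] [DiscreteMeasurableSpace κ]

lemma sum_cellMass (α : Measure X) [IsFiniteMeasure α] {c : X → κ} (hc : Measurable c) :
    ∑ j, cellMass α c j = α.real Set.univ := by
  have h := sum_measureReal_preimage_singleton (μ := α) (f := c) Finset.univ
    fun j _ => hc (measurableSet_singleton j)
  simpa [cellMass] using h

variable [DecidableEq κ]

/-- The next cell is drawn with weights proportional to the current posterior parameters, exactly
the weights with which a Dirichlet law mixes its one-step posteriors. -/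
lemma lintegral_comp_polyaPredictive (α : Measure X) [IsFiniteMeasure α] {c : X → κ}
    (hc : Measurable c) {n : ℕ} (y : Fin n → X) (h : κ → ℝ≥0∞) :
    ∫⁻ x, h (c x) ∂polyaPredictive α n y = (α Set.univ + n)⁻¹ *
      ∑ j, ENNReal.ofReal ((cellMass α c + fiberSum (c ∘ y) 1) j) * h j := by
  change ∫⁻ x, h (c x) ∂((α Set.univ + n)⁻¹ • (α + ∑ i, Measure.dirac (y i))) = _
  have hh : Measurable fun x => h (c x) := (measurable_of_countable h).comp hc
  rw [lintegral_smul_measure, smul_eq_mul, lintegral_add_measure, lintegral_finsetSum_measure]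
  congr 1
  simp only [lintegral_dirac' _ hh]
  rw [← lintegral_map (measurable_of_countable h) hc, lintegral_fintype]
  have e (j : κ) : ENNReal.ofReal ((cellMass α c + fiberSum (c ∘ y) 1) j) * h j =
      h j * (α.map c) {j} + ∑ i, if c (y i) = j then h j else 0 := by
    rw [Pi.add_apply, ENNReal.ofReal_add (cellMass_nonneg _ _ _)
      (fiberSum_nonneg (z := 1) _ (fun _ => zero_le_one) j), cellMass, ofReal_measureReal,
      Measure.map_apply hc (measurableSet_singleton j), add_mul, mul_comm]
    congr 1
    simp [fiberSum, Finset.sum_ite]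
  simp_rw [e]
  rw [Finset.sum_add_distrib]
  congr 1
  rw [Finset.sum_comm]
  simp

lemma lintegral_polyaLaw_succ (α : Measure X) [IsFiniteMeasure α] (hα : α ≠ 0) (n : ℕ)
    {g : (Fin (n + 1) → X) → ℝ≥0∞} (hg : Measurable g) :
    ∫⁻ y, g y ∂polyaLaw α (n + 1) =
      ∫⁻ y, ∫⁻ x, g (Fin.snoc (α := fun _ => X) y x) ∂polyaPredictive α n y ∂polyaLaw α n := by
  have := isMarkovKernel_polyaPredictive α hα n
  have := isProbabilityMeasure_polyaLaw α hα n
  rw [polyaLaw, lintegral_map hg measurable_snoc]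
  exact Measure.lintegral_compProd (hg.comp measurable_snoc)

/-- The posteriors of a Dirichlet vector given the first `n` terms of a Pólya sequence average to
the prior. -/
lemma lintegral_polyaLaw_dirichletMeasure (α : Measure X) [IsFiniteMeasure α] (hα : α ≠ 0)
    {c : X → κ} (hc : Measurable c) (n : ℕ) {f : (κ → ℝ) → ℝ≥0∞} (hf : Measurable f) :
    ∫⁻ y, ∫⁻ d, f d ∂dirichletMeasure (cellMass α c + fiberSum (c ∘ y) 1) ∂polyaLaw α n =
      ∫⁻ d, f d ∂dirichletMeasure (cellMass α c) := by
  have h0 : α Set.univ ≠ 0 := by simpa using hα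
  have hpos : 0 < α.real Set.univ := by have : NeZero α := ⟨hα⟩; exact measureReal_univ_pos
  induction n with
  | zero =>
    have := isProbabilityMeasure_polyaLaw α hα 0
    have (y : Fin 0 → X) : fiberSum (c ∘ y) 1 = 0 := by ext j; simp [fiberSum]
    simp [this]
  | succ n ih =>
    rw [← ih, lintegral_polyaLaw_succ α hα n]
    · refine lintegral_congr fun y => ?_
      set b := cellMass α c + fiberSum (c ∘ y) 1 with hb
      have hb0 : ∀ j, 0 ≤ b j := fun j =>
        add_nonneg (cellMass_nonneg _ _ _) (fiberSum_nonneg _ (fun _ => zero_le_one) j)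
      have hbs : ∑ j, b j = α.real Set.univ + n := by
        rw [hb, sum_add_fiberSum_one, sum_cellMass α hc]
      have e (x : X) : cellMass α c +
          fiberSum (c ∘ (Fin.snoc (α := fun _ => X) y x : Fin (n + 1) → X)) 1 =
          b + Pi.single (c x) 1 := by
        have h1 : (1 : Fin (n + 1) → ℝ) = Fin.snoc (α := fun _ => ℝ) (1 : Fin n → ℝ) 1 := by
          ext i; refine Fin.lastCases ?_ (fun i => ?_) i <;> simp
        rw [h1, Fin.comp_snoc, fiberSum_snoc, hb, add_assoc]
      simp_rw [e]
      refine (lintegral_comp_polyaPredictive α hc y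
        (fun j => ∫⁻ d, f d ∂dirichletMeasure (b + Pi.single j 1))).trans ?_
      rw [← hb, sum_mul_lintegral_dirichletMeasure_add_single hb0 (by rw [hbs]; positivity) hf, hbs,
        ENNReal.ofReal_add measureReal_nonneg (Nat.cast_nonneg n), ofReal_measureReal,
        ENNReal.ofReal_natCast, ← mul_assoc, ENNReal.inv_mul_cancel (by simp [h0]) (by finiteness),
        one_mul]
    -- The integrand depends on `y` only through the cells of its terms, which range over a
    -- countable discrete space; measurability in the Dirichlet parameter is not needed.
    · exact (measurable_of_countable fun k : Fin (n + 1) → κ =>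
        ∫⁻ d, f d ∂dirichletMeasure (cellMass α c + fiberSum k 1)).comp
        (measurable_pi_lambda _ fun i => hc.comp (measurable_pi_apply i))

lemma measurable_fiberSum_comp {n : ℕ} {c : X → κ} (hc : Measurable c) :
    Measurable fun w : (Fin n → ℝ) × (Fin n → X) => fiberSum (c ∘ w.2) w.1 := by
  refine measurable_pi_lambda _ fun j => ?_
  simp only [fiberSum, Finset.sum_filter, Function.comp_apply]
  refine Finset.measurable_fun_sum _ fun i _ => Measurable.ite ?_ (by fun_prop) measurable_const
  exact (hc.comp (by fun_prop : Measurable fun w : (Fin n → ℝ) × (Fin n → X) => w.2 i))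
    (measurableSet_singleton j)

/-- The joint law of the weight `θ` and of the cell probabilities of `∑ i, q i δ_{Y i}`. -/
noncomputable def cellInnovationLaw (α : Measure X) (n : ℕ) (c : X → κ) : Measure (ℝ × (κ → ℝ)) :=
  (innovationLaw α n).map fun z => (z.1, fiberSum (c ∘ z.2.2) z.2.1)

lemma measurable_cellInnovation {n : ℕ} {c : X → κ} (hc : Measurable c) :
    Measurable fun z : ℝ × (Fin n → ℝ) × (Fin n → X) => (z.1, fiberSum (c ∘ z.2.2) z.2.1) :=
  measurable_fst.prodMk ((measurable_fiberSum_comp hc).comp measurable_snd)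

/-- The Dirichlet distribution is stationary for the recursion of the cell probabilities. -/
lemma dirichletMeasure_stationary (α : Measure X) [IsFiniteMeasure α] (hα : α ≠ 0) {n : ℕ}
    (hn : 1 ≤ n) {c : X → κ} (hc : Measurable c) :
    ((cellInnovationLaw α n c).prod (dirichletMeasure (cellMass α c))).map
      (fun w => w.1.1 • w.1.2 + (1 - w.1.1) • w.2) = dirichletMeasure (cellMass α c) := by
  have hpos : 0 < α.real Set.univ := by have : NeZero α := ⟨hα⟩; exact measureReal_univ_pos
  have := isProbabilityMeasure_innovationLaw α hα hn
  have := isProbabilityMeasure_polyaLaw α hα n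
  have := isProbabilityMeasure_dirichletMeasure (a := fun _ : Fin n => 1) fun _ => zero_le_one
  have := isProbabilityMeasureBeta (α := n) (β := α.real Set.univ) (by exact_mod_cast hn) hpos
  have := isProbabilityMeasure_dirichletMeasure (cellMass_nonneg α c)
  have hi := measurable_cellInnovation (n := n) hc
  have : IsProbabilityMeasure (cellInnovationLaw α n c) :=
    Measure.isProbabilityMeasure_map hi.aemeasurable
  have hs := sum_cellMass α hc
  refine Measure.ext_of_lintegral _ fun f hf => ?_
  rw [lintegral_map hf (by fun_prop), lintegral_prod _ (by fun_prop), cellInnovationLaw,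
    lintegral_map (by fun_prop) hi, innovationLaw, ← lintegral_polyaLaw_dirichletMeasure α hα hc n hf]
  set g : ℝ × (κ → ℝ) → ℝ≥0∞ := fun a => ∫⁻ d, f (a.1 • a.2 + (1 - a.1) • d)
    ∂dirichletMeasure (cellMass α c) with hg
  have hgm : Measurable g := by fun_prop
  have hm : Measurable fun z : ℝ × (Fin n → ℝ) × (Fin n → X) =>
    g (z.1, fiberSum (c ∘ z.2.2) z.2.1) := hgm.comp hi
  rw [lintegral_prod_symm _ hm.aemeasurable, lintegral_prod_symm _
    (Measurable.lintegral_prod_left hm).aemeasurable]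
  refine lintegral_congr fun y => ?_
  -- With `y` fixed, both sides are integrals under the one-step posterior; averaging over `y` was
  -- already introduced on the right.
  rw [← map_betaMeasure_prod_dirichletMeasure hn (cellMass_nonneg α c) (by rwa [hs]) (c ∘ y), hs,
    lintegral_map hf (by fun_prop), lintegral_prod_symm _ (by fun_prop),
    lintegral_prod _ (by fun_prop)]
  refine lintegral_congr fun q => ?_
  exact lintegral_lintegral_swap (f := fun θ d => f (θ • fiberSum (c ∘ y) q + (1 - θ) • d))
    (by fun_prop)

end Polya

/-! ### Uniqueness of stationary laws by contraction. -/

section Uniqueness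

open Filter Topology
open scoped NNReal

variable {ι : Type*} [Fintype ι]

/-- A random affine contraction `x ↦ θ v + (1 - θ) x` has at most one stationary law with bounded
support. -/
lemma eq_of_stationary (ρ : Measure (ℝ × (ι → ℝ))) [IsProbabilityMeasure ρ]
    (hρ : ∀ᵐ w ∂ρ, w.1 ∈ Set.Ioo (0 : ℝ) 1) {ν ν' : Measure (ι → ℝ)} [IsProbabilityMeasure ν]
    [IsProbabilityMeasure ν'] (hR : (ρ.prod ν).map (fun w => w.1.1 • w.1.2 + (1 - w.1.1) • w.2) = ν)
    (hR' : (ρ.prod ν').map (fun w => w.1.1 • w.1.2 + (1 - w.1.1) • w.2) = ν') {C : ℝ}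
    (hC : ∀ᵐ x ∂ν, ‖x‖ ≤ C) (hC' : ∀ᵐ x ∂ν', ‖x‖ ≤ C) : ν = ν' := by
  have hint : Integrable (fun w : ℝ × (ι → ℝ) => 1 - w.1) ρ := by
    refine Integrable.of_bound (by fun_prop) 1 ?_
    filter_upwards [hρ] with w hw
    rw [Real.norm_of_nonneg (by linarith [hw.2])]
    linarith [hw.1]
  set k : ℝ := ∫ w, (1 - w.1) ∂ρ with hk
  have hk0 : 0 ≤ k := integral_nonneg_of_ae (hρ.mono fun w hw => by
    simp only [Pi.zero_apply]; linarith [hw.2])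
  have hk1 : k < 1 := by
    have : 0 < ∫ w, (1 - (1 - w.1)) ∂ρ := by
      rw [integral_pos_iff_support_of_nonneg_ae (f := fun w : ℝ × (ι → ℝ) => 1 - (1 - w.1))
        (hρ.mono fun w hw => by simp only [Pi.zero_apply]; linarith [hw.1])
        ((integrable_const _).sub hint)]
      refine lt_of_lt_of_le one_pos ?_
      rw [← measure_univ (μ := ρ)]
      refine measure_mono_ae ?_
      filter_upwards [hρ] with w hw _
      change 1 - (1 - w.1) ≠ 0
      linarith [hw.1]
    rw [integral_sub (integrable_const _) hint] at this
    simpa using this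
  have step (S : Measure (ι → ℝ)) [IsProbabilityMeasure S]
      (hS : (ρ.prod S).map (fun w => w.1.1 • w.1.2 + (1 - w.1.1) • w.2) = S)
      (φ : (ι → ℝ) → ℝ) (hφ : Continuous φ) (B : ℝ) (hB : ∀ x, ‖φ x‖ ≤ B) :
      ∫ x, φ x ∂S = ∫ x, ∫ w, φ (w.1 • w.2 + (1 - w.1) • x) ∂ρ ∂S := by
    conv_lhs => rw [← hS]
    rw [integral_map (by fun_prop) (by fun_prop), integral_prod_symm]
    exact Integrable.of_bound (by fun_prop) B (ae_of_all _ fun w => hB _)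
  -- Quantified over all `φ`, since a step replaces `φ` by its average over one move, whose
  -- Lipschitz constant is `k L` and whose bound is still `B`. For `N = 0` the two laws are coupled
  -- independently on a ball of radius `C`.
  have main (N : ℕ) : ∀ (φ : (ι → ℝ) → ℝ) (L : ℝ≥0) (B : ℝ), LipschitzWith L φ →
      (∀ x, ‖φ x‖ ≤ B) → |∫ x, φ x ∂ν - ∫ x, φ x ∂ν'| ≤ k ^ N * L * (2 * C) := by
    induction N with
    | zero =>
      intro φ L B hL hB
      have i1 : Integrable (fun w : (ι → ℝ) × (ι → ℝ) => φ w.1) (ν.prod ν') :=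
        Integrable.of_bound (hL.continuous.comp continuous_fst).aestronglyMeasurable B
          (ae_of_all _ fun w => hB _)
      have i2 : Integrable (fun w : (ι → ℝ) × (ι → ℝ) => φ w.2) (ν.prod ν') :=
        Integrable.of_bound (hL.continuous.comp continuous_snd).aestronglyMeasurable B
          (ae_of_all _ fun w => hB _)
      have e : ∫ x, φ x ∂ν - ∫ x, φ x ∂ν' = ∫ w, (φ w.1 - φ w.2) ∂ν.prod ν' := by
        rw [integral_sub i1 i2, integral_fun_fst, integral_fun_snd]; simp
      rw [e, ← Real.norm_eq_abs]
      refine (norm_integral_le_of_norm_le_const (C := L * (2 * C)) ?_).trans (by simp)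
      filter_upwards [Measure.quasiMeasurePreserving_fst.ae hC,
        Measure.quasiMeasurePreserving_snd.ae hC'] with w h1 h2
      rw [← dist_eq_norm]
      refine (hL.dist_le_mul _ _).trans (mul_le_mul_of_nonneg_left ?_ L.2)
      rw [dist_eq_norm]
      exact (norm_sub_le _ _).trans (by linarith)
    | succ N ih =>
      intro φ L B hL hB
      rw [step ν hR φ hL.continuous B hB, step ν' hR' φ hL.continuous B hB]
      have hint' (x : ι → ℝ) : Integrable (fun w => φ (w.1 • w.2 + (1 - w.1) • x)) ρ :=
        Integrable.of_bound (hL.continuous.comp (by fun_prop)).aestronglyMeasurable B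
          (ae_of_all _ fun w => hB _)
      have hlip : LipschitzWith (k.toNNReal * L)
          fun x => ∫ w, φ (w.1 • w.2 + (1 - w.1) • x) ∂ρ := by
        refine LipschitzWith.of_dist_le_mul fun x y => ?_
        rw [dist_eq_norm, ← integral_sub (hint' x) (hint' y)]
        have : ((k.toNNReal * L : ℝ≥0) : ℝ) * dist x y = ∫ w, (1 - w.1) * (L * dist x y) ∂ρ := by
          rw [integral_mul_const, NNReal.coe_mul, Real.coe_toNNReal _ hk0, mul_assoc]
        rw [this]
        refine norm_integral_le_of_norm_le (hint.mul_const _) ?_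
        filter_upwards [hρ] with w hw
        rw [← dist_eq_norm]
        refine (hL.dist_le_mul _ _).trans (le_of_eq ?_)
        rw [dist_add_left, dist_smul₀, Real.norm_of_nonneg (by linarith [hw.2])]
        ring
      refine (ih _ _ B hlip fun x => ?_).trans (le_of_eq ?_)
      · exact (norm_integral_le_of_norm_le_const (ae_of_all _ fun w => hB _)).trans (by simp)
      · rw [NNReal.coe_mul, Real.coe_toNNReal _ hk0]
        ring
  have heq (φ : (ι → ℝ) → ℝ) (L : ℝ≥0) (B : ℝ) (hL : LipschitzWith L φ) (hB : ∀ x, ‖φ x‖ ≤ B) :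
      ∫ x, φ x ∂ν = ∫ x, φ x ∂ν' := by
    have ht : Tendsto (fun N : ℕ => k ^ N * L * (2 * C)) atTop (𝓝 (0 * L * (2 * C))) :=
      ((tendsto_pow_atTop_nhds_zero_of_lt_one hk0 hk1).mul_const _).mul_const _
    have := ge_of_tendsto' ht fun N => main N φ L B hL hB
    rw [zero_mul, zero_mul] at this
    exact sub_eq_zero.1 (abs_nonpos_iff.1 this)
  -- Bounded Lipschitz functions determine the law: the constant sequence `P` converges weakly to
  -- `P'`, and limits are unique.
  let P : ProbabilityMeasure (ι → ℝ) := ⟨ν, inferInstance⟩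
  let P' : ProbabilityMeasure (ι → ℝ) := ⟨ν', inferInstance⟩
  have hT : Tendsto (fun _ : ℕ => P) atTop (𝓝 P') := by
    rw [tendsto_iff_forall_lipschitz_integral_tendsto]
    rintro f ⟨D, hD⟩ ⟨L, hL⟩
    have : ∫ x, f x ∂ν = ∫ x, f x ∂ν' := by
      refine heq f L (D + ‖f 0‖) hL fun x => ?_
      have h1 := hD x 0
      rw [dist_eq_norm] at h1
      linarith [norm_sub_norm_le (f x) (f 0)]
    exact tendsto_const_nhds.congr fun _ => this.symm
  have hPP : P = P' := tendsto_nhds_unique tendsto_const_nhds hT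
  exact congrArg Subtype.val hPP

end Uniqueness

/-! ### Prepending a term to an i.i.d. sequence, and splitting it off. -/

section Sequences

variable {E : Type*}

/-- Prepend a term to a sequence. -/
def seqCons (w : E × (ℕ → E)) : ℕ → E
  | 0 => w.1
  | k + 1 => w.2 k

variable [MeasurableSpace E]

lemma measurable_seqCons : Measurable (seqCons (E := E)) := by
  refine measurable_pi_lambda _ fun k => ?_
  cases k with
  | zero => exact measurable_fst
  | succ k => exact (measurable_pi_apply k).comp measurable_snd

lemma map_seqCons_prod_infinitePi (μ : Measure E) [IsProbabilityMeasure μ] :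
    (μ.prod (Measure.infinitePi fun _ : ℕ => μ)).map seqCons =
      Measure.infinitePi fun _ : ℕ => μ := by
  classical
  refine Measure.eq_infinitePi _ fun s t ht => ?_
  obtain ⟨N, hN⟩ := s.exists_nat_subset_range
  -- Pads the cylinder by full sets to an initial segment of times, from which coordinate `0` can be
  -- separated.
  set t' : ℕ → Set E := fun i => if i ∈ s then t i else Set.univ with ht'
  have hm (i : ℕ) : MeasurableSet (t' i) := by
    simp only [ht']; split_ifs
    exacts [ht i, .univ]
  have h1 : Set.pi (s : Set ℕ) t = Set.pi (Finset.range (N + 1) : Set ℕ) t' := by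
    ext z
    simp only [Set.mem_pi, Finset.mem_coe, ht']
    refine ⟨fun h i _ => ?_, fun h i hi => ?_⟩
    · split_ifs with his
      exacts [h i his, trivial]
    · have := h i (Finset.range_subset_range.2 N.le_succ (hN hi))
      rwa [if_pos hi] at this
  have h2 : ∏ i ∈ s, μ (t i) = ∏ i ∈ Finset.range (N + 1), μ (t' i) := by
    rw [← Finset.prod_subset (hN.trans (Finset.range_subset_range.2 N.le_succ))
      (fun i _ hi => by simp [ht', hi])]
    exact Finset.prod_congr rfl fun i hi => by simp [ht', hi]
  have h3 : seqCons ⁻¹' (Set.pi (Finset.range (N + 1) : Set ℕ) t') =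
      t' 0 ×ˢ Set.pi (Finset.range N : Set ℕ) fun i => t' (i + 1) := by
    ext w
    simp only [Set.mem_preimage, Set.mem_pi, Finset.mem_coe, Finset.mem_range, Set.mem_prod]
    refine ⟨fun h => ⟨h 0 (by omega), fun i hi => h (i + 1) (by omega)⟩, fun h i hi => ?_⟩
    cases i with
    | zero => exact h.1
    | succ i => exact h.2 i (by omega)
  rw [h1, h2, Measure.map_apply measurable_seqCons
    (.pi (Finset.countable_toSet _) fun i _ => hm i), h3, Measure.prod_prod,
    Measure.infinitePi_pi _ (fun i _ => hm _), Finset.prod_range_succ', mul_comm]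

lemma map_uncons_infinitePi (μ : Measure E) [IsProbabilityMeasure μ] :
    (Measure.infinitePi fun _ : ℕ => μ).map (fun z => (z 0, fun k => z (k + 1))) =
      μ.prod (Measure.infinitePi fun _ : ℕ => μ) := by
  conv_lhs => rw [← map_seqCons_prod_infinitePi μ]
  rw [Measure.map_map (by fun_prop) measurable_seqCons]
  exact Measure.map_id

end Sequences

/-! ### One step of the chain. -/

section Step

open scoped ENNReal

variable {X : Type*} [MeasurableSpace X]

lemma mixture_apply {n : ℕ} (t : ℝ) (q : Fin n → ℝ) (y : Fin n → X) (μ : Measure X) (s : Set X) :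
    mixture t q y μ s = ENNReal.ofReal t * ∑ i, ENNReal.ofReal (q i) * Measure.dirac (y i) s +
      ENNReal.ofReal (1 - t) * μ s := by
  simp [mixture, Measure.add_apply, Measure.smul_apply, Measure.finsetSum_apply]

lemma mixture_univ {n : ℕ} {t : ℝ} {q : Fin n → ℝ} (hq : q ∈ stdSimplex ℝ (Fin n))
    (y : Fin n → X) (μ : Measure X) :
    mixture t q y μ Set.univ = ENNReal.ofReal t + ENNReal.ofReal (1 - t) * μ Set.univ := by
  rw [mixture_apply]
  simp only [measure_univ, mul_one]
  rw [← ENNReal.ofReal_sum_of_nonneg (fun i _ => hq.1 i), hq.2, ENNReal.ofReal_one, mul_one]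

lemma isProbabilityMeasure_mixture {n : ℕ} {t : ℝ} (ht : t ∈ Set.Ioo (0 : ℝ) 1) {q : Fin n → ℝ}
    (hq : q ∈ stdSimplex ℝ (Fin n)) (y : Fin n → X) (μ : Measure X) [IsProbabilityMeasure μ] :
    IsProbabilityMeasure (mixture t q y μ) := by
  refine ⟨?_⟩
  rw [mixture_univ hq, measure_univ, mul_one, ← ENNReal.ofReal_add ht.1.le (by linarith [ht.2])]
  simp

lemma coe_step {n : ℕ} {μ : ProbabilityMeasure X} {z : ℝ × (Fin n → ℝ) × (Fin n → X)}
    (h : IsProbabilityMeasure (mixture z.1 z.2.1 z.2.2 (μ : Measure X))) :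
    (step μ z : Measure X) = mixture z.1 z.2.1 z.2.2 (μ : Measure X) := by
  simp [step, h]

lemma lintegral_transitionKernel (α : Measure X) (n : ℕ) (μ : ProbabilityMeasure X)
    {f : ProbabilityMeasure X → ℝ≥0∞} (hf : Measurable f) :
    ∫⁻ p, f p ∂transitionKernel α n μ = ∫⁻ z, f (step μ z) ∂innovationLaw α n :=
  lintegral_map hf (measurable_step.comp measurable_prodMk_left)

lemma isMarkovKernel_transitionKernel (α : Measure X) [IsFiniteMeasure α] (hα : α ≠ 0) {n : ℕ}
    (hn : 1 ≤ n) : IsMarkovKernel (transitionKernel α n) := by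
  have := isProbabilityMeasure_innovationLaw α hα hn
  exact ⟨fun μ => Measure.isProbabilityMeasure_map
    (measurable_step.comp measurable_prodMk_left).aemeasurable⟩

lemma measurable_history_step {n : ℕ} (m : ℕ) :
    Measurable fun w : (Fin (m + 1) → ProbabilityMeasure X) ×
      (ℝ × (Fin n → ℝ) × (Fin n → X)) => (w.1, step (w.1 (Fin.last m)) w.2) := by
  have h0 : Measurable fun h : Fin (m + 1) → ProbabilityMeasure X => h (Fin.last m) :=
    measurable_pi_apply _
  have h1 : Measurable fun w : (Fin (m + 1) → ProbabilityMeasure X) ×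
      (ℝ × (Fin n → ℝ) × (Fin n → X)) => (w.1 (Fin.last m), w.2) :=
    (h0.comp measurable_fst).prodMk measurable_snd
  have h2 := measurable_step.comp h1
  exact measurable_fst.prodMk h2

end Step

/-! ### The Markov property. -/

section Markov

variable {X : Type*} [MeasurableSpace X]

variable {α : Measure X} {n : ℕ} {Ω : Type*} [MeasurableSpace Ω]
  {Pr : Measure Ω} {θ : ℕ → Ω → ℝ} {q : ℕ → Ω → Fin n → ℝ}
  {Y : ℕ → Ω → Fin n → X} {P : ℕ → Ω → ProbabilityMeasure X}

/-- The recursion itself forces the mixture to be a probability measure, so the default branch of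
`step` plays no role. -/
lemma IsChain.ae_eq_step (h : IsChain α n Pr θ q Y P) (m : ℕ) :
    ∀ᵐ ω ∂Pr, P (m + 1) ω = step (P m ω) (θ m ω, q m ω, Y m ω) := by
  filter_upwards [h.recursion m] with ω hω
  refine Subtype.ext ?_
  have : IsProbabilityMeasure (mixture (θ m ω) (q m ω) (Y m ω) (P m ω : Measure X)) := by
    rw [← hω]; infer_instance
  exact hω.trans (coe_step (z := (θ m ω, q m ω, Y m ω)) this).symm

lemma IsChain.measurable_history (h : IsChain α n Pr θ q Y P) (m : ℕ) :
    Measurable fun ω (i : Fin (m + 1)) => P i ω :=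
  measurable_pi_lambda _ fun i => h.measurable_P i

lemma IsChain.measurable_innovation (h : IsChain α n Pr θ q Y P) (m : ℕ) :
    Measurable fun ω => (θ m ω, q m ω, Y m ω) :=
  (h.measurable_θ m).prodMk ((h.measurable_q m).prodMk (h.measurable_Y m))

variable [IsProbabilityMeasure Pr]

/-- The history of the chain up to time `m` is independent of the later innovations. -/
lemma IsChain.map_history_innovations [IsProbabilityMeasure (innovationLaw α n)]
    (h : IsChain α n Pr θ q Y P) (m : ℕ) :
    Pr.map (fun ω => (fun i : Fin (m + 1) => P i ω,
      fun j => (θ (m + j) ω, q (m + j) ω, Y (m + j) ω))) =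
      (Pr.map fun ω (i : Fin (m + 1)) => P i ω).prod
        (Measure.infinitePi fun _ : ℕ => innovationLaw α n) := by
  have hZ (m : ℕ) : Measurable fun ω (j : ℕ) => (θ (m + j) ω, q (m + j) ω, Y (m + j) ω) :=
    measurable_pi_lambda _ fun j => h.measurable_innovation (m + j)
  have hZ0 : Measurable fun ω (j : ℕ) => (θ j ω, q j ω, Y j ω) :=
    measurable_pi_lambda _ fun j => h.measurable_innovation j
  induction m with
  | zero =>
    have hH : Measurable fun (p : ProbabilityMeasure X) (_ : Fin 1) => p := by fun_prop
    have e : (fun ω => (fun i : Fin (0 + 1) => P i ω,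
        fun j => (θ (0 + j) ω, q (0 + j) ω, Y (0 + j) ω))) =
        Prod.map (fun (p : ProbabilityMeasure X) (_ : Fin 1) => p) id ∘
        fun ω => (P 0 ω, fun j => (θ j ω, q j ω, Y j ω)) := by
      funext ω
      refine Prod.ext ?_ ?_
      · funext i
        simp
      · simp
    have e' : (fun ω (i : Fin (0 + 1)) => P i ω) =
        (fun (p : ProbabilityMeasure X) (_ : Fin 1) => p) ∘ P 0 := by
      funext ω i
      simp
    have h1 := (indepFun_iff_map_prod_eq_prod_map_map (h.measurable_P 0).aemeasurable
      hZ0.aemeasurable).1 h.indep_initial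
    have h2 := (h.iIndep.hasLaw_infinitePi h.hasLaw hZ0.aemeasurable).map_eq
    have := Measure.isProbabilityMeasure_map (μ := Pr) (h.measurable_P 0).aemeasurable
    rw [e, e', ← Measure.map_map (hH.prodMap measurable_id) ((h.measurable_P 0).prodMk hZ0), h1, h2,
      ← Measure.map_map hH (h.measurable_P 0), ← Measure.map_prod_map _ _ hH measurable_id,
      Measure.map_id]
  | succ m ih =>
    set I := innovationLaw α n
    set ν := Pr.map fun ω (i : Fin (m + 1)) => P i ω
    have : IsProbabilityMeasure ν :=
      Measure.isProbabilityMeasure_map (h.measurable_history m).aemeasurable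
    let g : (Fin (m + 1) → ProbabilityMeasure X) × (ℝ × (Fin n → ℝ) × (Fin n → X)) →
        Fin (m + 2) → ProbabilityMeasure X :=
      fun w => Fin.snoc (α := fun _ => ProbabilityMeasure X) w.1 (step (w.1 (Fin.last m)) w.2)
    have hg : Measurable g := measurable_snoc.comp (measurable_fst.prodMk
      (measurable_step.comp (((measurable_pi_apply _).comp measurable_fst).prodMk measurable_snd)))
    have hgP : (fun ω (i : Fin (m + 2)) => P i ω) =ᵐ[Pr]
        fun ω => g (fun i : Fin (m + 1) => P i ω, (θ m ω, q m ω, Y m ω)) := by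
      filter_upwards [h.ae_eq_step m] with ω hω
      funext i
      refine Fin.lastCases ?_ (fun i => ?_) i
      · simpa [g] using hω
      · simp [g]
    have hun : Measurable fun w : (Fin (m + 1) → ProbabilityMeasure X) ×
        (ℕ → ℝ × (Fin n → ℝ) × (Fin n → X)) => ((w.1, w.2 0), fun k => w.2 (k + 1)) := by
      fun_prop
    -- Moves the first future innovation next to the history. The entire remaining sequence stays in
    -- the statement, so that the induction can continue.
    have key : Pr.map (fun ω => ((fun i : Fin (m + 1) => P i ω, (θ m ω, q m ω, Y m ω)),
        fun j => (θ (m + 1 + j) ω, q (m + 1 + j) ω, Y (m + 1 + j) ω))) =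
        (ν.prod I).prod (Measure.infinitePi fun _ : ℕ => I) := by
      have e : (fun ω => ((fun i : Fin (m + 1) => P i ω, (θ m ω, q m ω, Y m ω)),
          fun j => (θ (m + 1 + j) ω, q (m + 1 + j) ω, Y (m + 1 + j) ω))) =
          (fun w : (Fin (m + 1) → ProbabilityMeasure X) ×
          (ℕ → ℝ × (Fin n → ℝ) × (Fin n → X)) => ((w.1, w.2 0), fun k => w.2 (k + 1))) ∘
          fun ω => (fun i : Fin (m + 1) => P i ω,
            fun j => (θ (m + j) ω, q (m + j) ω, Y (m + j) ω)) := by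
        funext ω
        simp [add_assoc, add_comm 1]
      rw [e, ← Measure.map_map hun ((h.measurable_history m).prodMk (hZ m)), ih]
      have e2 : (fun w : (Fin (m + 1) → ProbabilityMeasure X) ×
          (ℕ → ℝ × (Fin n → ℝ) × (Fin n → X)) => ((w.1, w.2 0), fun k => w.2 (k + 1))) =
          MeasurableEquiv.prodAssoc.symm ∘ Prod.map id fun z => (z 0, fun k => z (k + 1)) := rfl
      rw [e2, ← Measure.map_map (MeasurableEquiv.measurable _) (by fun_prop),
        ← Measure.map_prod_map _ _ measurable_id (by fun_prop), Measure.map_id,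
        map_uncons_infinitePi, ← Measure.prodAssoc_prod, MeasurableEquiv.map_symm_map]
    have key1 : Pr.map (fun ω => (fun i : Fin (m + 1) => P i ω, (θ m ω, q m ω, Y m ω))) =
        ν.prod I := by
      have := congrArg (Measure.map Prod.fst) key
      rwa [Measure.map_map measurable_fst (((h.measurable_history m).prodMk
        (h.measurable_innovation m)).prodMk (hZ (m + 1))), Measure.map_fst_prod, measure_univ,
        one_smul] at this
    have hm : Measurable fun ω => (fun i : Fin (m + 1) => P i ω, (θ m ω, q m ω, Y m ω)) :=
      (h.measurable_history m).prodMk (h.measurable_innovation m)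
    have hgP' : (fun ω => (fun i : Fin (m + 2) => P i ω,
        fun j => (θ (m + 1 + j) ω, q (m + 1 + j) ω, Y (m + 1 + j) ω))) =ᵐ[Pr]
        fun ω => Prod.map g id ((fun i : Fin (m + 1) => P i ω, (θ m ω, q m ω, Y m ω)),
        fun j => (θ (m + 1 + j) ω, q (m + 1 + j) ω, Y (m + 1 + j) ω)) :=
      hgP.mono fun ω hω => Prod.ext hω rfl
    rw [Measure.map_congr hgP, Measure.map_congr hgP']
    have e3 := Measure.map_map (μ := Pr) (hg.prodMap measurable_id) (hm.prodMk (hZ (m + 1)))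
    have e4 := Measure.map_map (μ := Pr) hg hm
    rw [Function.comp_def] at e3 e4
    rw [← e3, ← e4, key, key1, ← Measure.map_prod_map _ _ hg measurable_id, Measure.map_id]

/-- Applying `step` to the last state of the history and an independent innovation gives, by
definition of the kernel, the joint law of the history and the next state. -/
lemma IsChain.hasCondDistrib [IsFiniteMeasure α] (hα : α ≠ 0) (hn : 1 ≤ n)
    (h : IsChain α n Pr θ q Y P) (m : ℕ) :
    HasCondDistrib (P (m + 1)) (fun ω (i : Fin (m + 1)) => P i ω)
      ((transitionKernel α n).comap (fun h => h (Fin.last m)) (measurable_pi_apply _)) Pr := by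
  have := isProbabilityMeasure_innovationLaw α hα hn
  have := isMarkovKernel_transitionKernel α hα hn
  have hH := h.measurable_history m
  have : IsProbabilityMeasure (Pr.map fun ω (i : Fin (m + 1)) => P i ω) :=
    Measure.isProbabilityMeasure_map hH.aemeasurable
  have key : Pr.map (fun ω => (fun i : Fin (m + 1) => P i ω, (θ m ω, q m ω, Y m ω))) =
      (Pr.map fun ω (i : Fin (m + 1)) => P i ω).prod (innovationLaw α n) := by
    have hf : Measurable fun z : ℕ → ℝ × (Fin n → ℝ) × (Fin n → X) => z 0 := measurable_pi_apply 0
    have e := h.map_history_innovations m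
    have e1 := Measure.map_map (μ := Pr) (measurable_id.prodMap hf)
      (hH.prodMk (measurable_pi_lambda _ fun j => h.measurable_innovation (m + j)))
    rw [e, ← Measure.map_prod_map _ _ measurable_id hf, Measure.map_id,
      Measure.infinitePi_map_eval (fun _ : ℕ => innovationLaw α n) 0] at e1
    exact e1.symm
  refine ⟨(hH.prodMk (h.measurable_P (m + 1))).aemeasurable, ?_⟩
  have e : (fun ω => (fun i : Fin (m + 1) => P i ω, P (m + 1) ω)) =ᵐ[Pr]
      fun ω => (fun w : (Fin (m + 1) → ProbabilityMeasure X) ×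
        (ℝ × (Fin n → ℝ) × (Fin n → X)) => (w.1, step (w.1 (Fin.last m)) w.2))
        (fun i : Fin (m + 1) => P i ω, (θ m ω, q m ω, Y m ω)) :=
    (h.ae_eq_step m).mono fun ω hω => Prod.ext rfl hω
  have hs := measurable_history_step (X := X) (n := n) m
  have e4 := Measure.map_map (μ := Pr) hs (hH.prodMk (h.measurable_innovation m))
  rw [Measure.map_congr e]
  rw [key] at e4
  refine e4.symm.trans ?_
  refine Measure.ext_of_lintegral _ fun f hf => ?_
  rw [lintegral_map hf hs, lintegral_prod (fun w => f (w.1, step (w.1 (Fin.last m)) w.2))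
    (hf.comp hs).aemeasurable, Measure.lintegral_compProd hf]
  refine lintegral_congr fun p => ?_
  rw [Kernel.comap_apply]
  exact (lintegral_transitionKernel α n _ (hf.comp measurable_prodMk_left)).symm

end Markov

/-! ### Invariant laws have Dirichlet marginals, and the marginals determine the law. -/

section Invariant

open scoped ENNReal

variable {X : Type*} [MeasurableSpace X] {κ : Type*} [Fintype κ]
  [MeasurableSpace κ] [DiscreteMeasurableSpace κ]

lemma measurable_cellMass {c : X → κ} (hc : Measurable c) :
    Measurable fun p : ProbabilityMeasure X => cellMass (p : Measure X) c := by
  refine measurable_pi_lambda _ fun j => ?_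
  exact ((Measure.measurable_coe (hc (measurableSet_singleton j))).comp
    measurable_subtype_coe).ennreal_toReal

variable [DecidableEq κ]

lemma cellMass_mixture {n : ℕ} {t : ℝ} (ht : t ∈ Set.Ioo (0 : ℝ) 1) {q : Fin n → ℝ}
    (hq : q ∈ stdSimplex ℝ (Fin n)) (y : Fin n → X) (μ : Measure X) [IsFiniteMeasure μ]
    {c : X → κ} (hc : Measurable c) :
    cellMass (mixture t q y μ) c = t • fiberSum (c ∘ y) q + (1 - t) • cellMass μ c := by
  funext j
  have hm := hc (measurableSet_singleton j)
  have h1 (i : Fin n) : ENNReal.ofReal (q i) * Measure.dirac (y i) (c ⁻¹' {j}) =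
      ENNReal.ofReal (if c (y i) = j then q i else 0) := by
    rw [Measure.dirac_apply' _ hm]
    by_cases h : c (y i) = j <;> simp [h]
  simp only [cellMass, measureReal_def, Pi.add_apply, Pi.smul_apply, smul_eq_mul, mixture_apply, h1]
  have h2 (i : Fin n) : 0 ≤ if c (y i) = j then q i else 0 := by split_ifs; exacts [hq.1 i, le_rfl]
  rw [← ENNReal.ofReal_sum_of_nonneg (fun i _ => h2 i),
    ENNReal.toReal_add (by finiteness) (by finiteness), ENNReal.toReal_mul, ENNReal.toReal_mul,
    ENNReal.toReal_ofReal ht.1.le, ENNReal.toReal_ofReal (Finset.sum_nonneg fun i _ => h2 i),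
    ENNReal.toReal_ofReal (by linarith [ht.2])]
  simp [fiberSum, Finset.sum_filter]

/-- The cell probabilities of a random measure with invariant law have a Dirichlet law. -/
lemma map_cellMass_of_invariant (α : Measure X) [IsFiniteMeasure α] (hα : α ≠ 0) {n : ℕ}
    (hn : 1 ≤ n) {Q : Measure (ProbabilityMeasure X)} [IsProbabilityMeasure Q]
    (hQ : (transitionKernel α n).Invariant Q) {c : X → κ} (hc : Measurable c) :
    Q.map (fun p : ProbabilityMeasure X => cellMass (p : Measure X) c) = dirichletMeasure (cellMass α c) := by
  have hpos : 0 < α.real Set.univ := by have : NeZero α := ⟨hα⟩; exact measureReal_univ_pos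
  have := isProbabilityMeasure_innovationLaw α hα hn
  have hi := measurable_cellInnovation (n := n) hc
  have hcm := measurable_cellMass hc
  have : IsProbabilityMeasure (cellInnovationLaw α n c) :=
    Measure.isProbabilityMeasure_map hi.aemeasurable
  have : IsProbabilityMeasure (Q.map fun p : ProbabilityMeasure X => cellMass (p : Measure X) c) :=
    Measure.isProbabilityMeasure_map hcm.aemeasurable
  have := isProbabilityMeasure_dirichletMeasure (cellMass_nonneg α c)
  refine eq_of_stationary (cellInnovationLaw α n c) ?_ ?_ (dirichletMeasure_stationary α hα hn hc)
    (C := 1) ?_ ?_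
  · refine (ae_map_iff hi.aemeasurable (measurable_fst measurableSet_Ioo)).2 ?_
    exact (ae_innovationLaw α hα hn).mono fun z hz => hz.1
  -- Invariance of `Q` passes to cell masses, since the cell masses after a step depend on the old
  -- state only through its cell masses.
  · refine Measure.ext_of_lintegral _ fun f hf => ?_
    rw [lintegral_map hf (by fun_prop), lintegral_prod_symm _ (by fun_prop),
      lintegral_map (by fun_prop) hcm, lintegral_map hf hcm]
    conv_rhs => rw [← hQ.def]
    refine Eq.trans ?_
      (Measure.lintegral_bind (Kernel.aemeasurable _) (hf.comp hcm).aemeasurable).symm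
    refine lintegral_congr fun p => ?_
    refine Eq.trans ?_ (lintegral_transitionKernel α n p (hf.comp hcm)).symm
    rw [cellInnovationLaw, lintegral_map (by fun_prop) hi]
    refine lintegral_congr_ae ?_
    filter_upwards [ae_innovationLaw α hα hn] with z hz
    have h1 := isProbabilityMeasure_mixture hz.1 hz.2 z.2.2 (p : Measure X)
    rw [Function.comp_apply, coe_step h1, cellMass_mixture hz.1 hz.2 _ _ hc]
  · refine (ae_map_iff hcm.aemeasurable (measurableSet_le (by fun_prop) (by fun_prop))).2 ?_
    refine ae_of_all _ fun p => (pi_norm_le_iff_of_nonneg zero_le_one).2 fun j => ?_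
    rw [Real.norm_of_nonneg (cellMass_nonneg _ _ _)]
    exact measureReal_le_one
  · filter_upwards [ae_mem_stdSimplex_dirichletMeasure (cellMass_nonneg α c)
      (by rwa [sum_cellMass α hc])] with d hd
    refine (pi_norm_le_iff_of_nonneg zero_le_one).2 fun j => ?_
    rw [Real.norm_of_nonneg (hd.1 j), ← hd.2]
    exact Finset.single_le_sum (fun i _ => hd.1 i) (Finset.mem_univ j)

/-- A partition is the family of fibres of the measurable map that sends a point to the index of its
cell. -/
lemma isDirichletProcessLaw_of_invariant (α : Measure X) [IsFiniteMeasure α] (hα : α ≠ 0) {n : ℕ}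
    (hn : 1 ≤ n) {Q : Measure (ProbabilityMeasure X)} [IsProbabilityMeasure Q]
    (hQ : (transitionKernel α n).Invariant Q) : IsDirichletProcessLaw α Q := by
  refine ⟨inferInstance, fun k B hB hd hU => ?_⟩
  have hex (x : X) : ∃ i, x ∈ B i := by
    simpa using (hU ▸ Set.mem_univ x : x ∈ ⋃ i, B i)
  choose c hc using hex
  have hcB (i : Fin k) : c ⁻¹' {i} = B i := by
    ext x
    simp only [Set.mem_preimage, Set.mem_singleton_iff]
    refine ⟨fun h => h ▸ hc x, fun h => ?_⟩
    by_contra hne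
    exact Set.disjoint_left.1 (hd hne) (hc x) h
  have hcm : Measurable c := measurable_to_countable' fun i => hcB i ▸ hB i
  have := map_cellMass_of_invariant α hα hn hQ hcm
  have e (p : Measure X) : cellMass p c = fun i => p.real (B i) := by
    funext i
    rw [cellMass, hcB]
  simpa only [e] using this

/-- There is at most one law of a Dirichlet process with a given parameter. -/
lemma IsDirichletProcessLaw.unique {α : Measure X} {Q Q' : Measure (ProbabilityMeasure X)}
    (hQ : IsDirichletProcessLaw α Q) (hQ' : IsDirichletProcessLaw α Q') : Q = Q' := by
  have := hQ.isProbabilityMeasure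
  have := hQ'.isProbabilityMeasure
  let Φ : ProbabilityMeasure X → {A : Set X // MeasurableSet A} → ℝ :=
    fun p A => (p : Measure X).real A
  have hΦ : Measurable Φ := measurable_pi_lambda _ fun A =>
    ((Measure.measurable_coe A.2).comp measurable_subtype_coe).ennreal_toReal
  -- The σ-field is generated by the evaluations, so the joint law of all masses `p A`, and hence
  -- its finite-dimensional marginals, determine `Q`.
  have hle : (inferInstance : MeasurableSpace (ProbabilityMeasure X)) ≤
      MeasurableSpace.comap Φ inferInstance := by
    change MeasurableSpace.comap Subtype.val (⨆ (s : Set X) (_ : MeasurableSet s),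
      (borel ℝ≥0∞).comap fun μ : Measure X => μ s) ≤ _
    simp only [MeasurableSpace.comap_iSup, MeasurableSpace.comap_comp]
    refine iSup₂_le fun s hs => ?_
    have : (fun μ : Measure X => μ s) ∘ (Subtype.val : {μ : Measure X // IsProbabilityMeasure μ} →
        Measure X) = (fun v => ENNReal.ofReal (v ⟨s, hs⟩)) ∘ Φ := by
      funext p
      have := p.2
      exact (ofReal_measureReal (μ := p.1) (s := s)).symm
    have hm : Measurable fun v : {A : Set X // MeasurableSet A} → ℝ => ENNReal.ofReal (v ⟨s, hs⟩) := by
      fun_prop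
    rw [this]
    rintro _ ⟨t, ht, rfl⟩
    exact ⟨_, hm ht, rfl⟩
  have hmap : Q.map Φ = Q'.map Φ := by
    have := Measure.isProbabilityMeasure_map (μ := Q) hΦ.aemeasurable
    have := Measure.isProbabilityMeasure_map (μ := Q') hΦ.aemeasurable
    refine IsProjectiveLimit.unique (P := fun J => (Q.map Φ).map J.restrict) (fun J => rfl)
      (fun J => ?_)
    classical
    -- The sets in `J` need not form a partition. Points are sorted by their membership pattern,
    -- possibly with empty cells, and `ψ` recovers each mass by summing over the patterns inside the
    -- set.
    let e := Fintype.equivFin (J → Bool)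
    let c : X → Fin (Fintype.card (J → Bool)) := fun x => e fun A => decide (x ∈ A.1.1)
    have hc : Measurable c := by
      refine (measurable_of_countable e).comp (measurable_pi_lambda _ fun A => ?_)
      refine measurable_to_bool ?_
      convert A.1.2 using 1
      ext x
      simp
    let ψ : (Fin (Fintype.card (J → Bool)) → ℝ) → J → ℝ :=
      fun v A => ∑ i with e.symm i A = true, v i
    have hψ : Measurable ψ := by fun_prop
    have h1 : J.restrict ∘ Φ = ψ ∘ fun p : ProbabilityMeasure X => cellMass (p : Measure X) c := by
      funext p A
      have hA : (A.1.1 : Set X) = c ⁻¹' ((Finset.univ.filter fun i => e.symm i A = true :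
          Finset (Fin (Fintype.card (J → Bool)))) : Set _) := by
        ext x; simp [c]
      simp only [Function.comp_apply, ψ, cellMass, Φ, Finset.restrict]
      rw [sum_measureReal_preimage_singleton _ fun j _ => hc (measurableSet_singleton j), ← hA]
    have h2 : Q.map (fun p : ProbabilityMeasure X => cellMass (p : Measure X) c) =
        Q'.map (fun p : ProbabilityMeasure X => cellMass (p : Measure X) c) := by
      have hm (i) : MeasurableSet (c ⁻¹' {i}) := hc (measurableSet_singleton i)
      have hd : Pairwise fun i j => Disjoint (c ⁻¹' {i}) (c ⁻¹' {j}) := fun i j hij =>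
        Disjoint.preimage _ (by simpa using hij)
      have hU : ⋃ i, c ⁻¹' {i} = Set.univ := by ext x; simp
      exact (hQ.map_eq _ _ hm hd hU).trans (hQ'.map_eq _ _ hm hd hU).symm
    have hr : Measurable (J.restrict : ({A : Set X // MeasurableSet A} → ℝ) → J → ℝ) := by
      fun_prop
    change (Q'.map Φ).map J.restrict = (Q.map Φ).map J.restrict
    rw [Measure.map_map hr hΦ, Measure.map_map hr hΦ, h1,
      ← Measure.map_map hψ (measurable_cellMass hc), ← Measure.map_map hψ (measurable_cellMass hc),
      h2]
  refine Measure.ext fun s hs => ?_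
  obtain ⟨t, ht, rfl⟩ := hle s hs
  rw [← Measure.map_apply hΦ ht, hmap, Measure.map_apply hΦ ht]

end Invariant

/-! ### Existence of an invariant law by stick-breaking. -/

section Existence

open scoped ENNReal

variable {X : Type*} [MeasurableSpace X] {n : ℕ}

/-- The limit of the backward iterates of the recursion driven by the innovations `z`:
`∑ j, θ j ∏ i < j, (1 - θ i) ∑ i, q j i δ_{Y j i}`. -/
noncomputable def stickMeasure (z : ℕ → ℝ × (Fin n → ℝ) × (Fin n → X)) : Measure X :=
  Measure.sum fun j => (ENNReal.ofReal (z j).1 * ∏ i ∈ Finset.range j, ENNReal.ofReal (1 - (z i).1)) •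
    ∑ i, ENNReal.ofReal ((z j).2.1 i) • Measure.dirac ((z j).2.2 i)

lemma stickMeasure_apply (z : ℕ → ℝ × (Fin n → ℝ) × (Fin n → X)) {s : Set X}
    (hs : MeasurableSet s) :
    stickMeasure z s = ∑' j, (ENNReal.ofReal (z j).1 *
      ∏ i ∈ Finset.range j, ENNReal.ofReal (1 - (z i).1)) *
      ∑ i, ENNReal.ofReal ((z j).2.1 i) * Measure.dirac ((z j).2.2 i) s := by
  rw [stickMeasure, Measure.sum_apply _ hs]
  simp [Measure.smul_apply, Measure.finsetSum_apply]

lemma measurable_stickMeasure : Measurable (stickMeasure (X := X) (n := n)) := by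
  refine Measure.measurable_of_measurable_coe _ fun s hs => ?_
  simp only [stickMeasure_apply _ hs]
  have h1 (j : ℕ) (i : Fin n) : Measurable fun z : ℕ → ℝ × (Fin n → ℝ) × (Fin n → X) =>
      Measure.dirac ((z j).2.2 i) s :=
    (Measure.measurable_coe hs).comp (Measure.measurable_dirac.comp (by fun_prop))
  refine Measurable.tsum fun j => ?_
  fun_prop

lemma stickMeasure_seqCons (w : (ℝ × (Fin n → ℝ) × (Fin n → X)) ×
    (ℕ → ℝ × (Fin n → ℝ) × (Fin n → X))) :
    stickMeasure (seqCons w) = mixture w.1.1 w.1.2.1 w.1.2.2 (stickMeasure w.2) := by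
  refine Measure.ext fun s hs => ?_
  rw [mixture_apply, stickMeasure_apply _ hs, stickMeasure_apply _ hs,
    tsum_eq_zero_add' ENNReal.summable, ← ENNReal.tsum_mul_left]
  simp only [Finset.prod_range_succ', seqCons, Finset.range_zero, Finset.prod_empty, mul_one]
  congr 1
  refine tsum_congr fun j => ?_
  ring

/-- After `N` terms, the mass already assigned and the remaining stick `∏ i < N, (1 - θ i)` add up
to `1`. -/
lemma stickMeasure_univ_le_one {z : ℕ → ℝ × (Fin n → ℝ) × (Fin n → X)}
    (hz : ∀ j, (z j).1 ∈ Set.Ioo (0 : ℝ) 1 ∧ (z j).2.1 ∈ stdSimplex ℝ (Fin n)) :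
    stickMeasure z Set.univ ≤ 1 := by
  rw [stickMeasure_apply _ .univ]
  have h1 (j : ℕ) : ∑ i, ENNReal.ofReal ((z j).2.1 i) * Measure.dirac ((z j).2.2 i) Set.univ = 1 := by
    simp only [measure_univ, mul_one]
    rw [← ENNReal.ofReal_sum_of_nonneg (fun i _ => (hz j).2.1 i), (hz j).2.2, ENNReal.ofReal_one]
  simp only [h1, mul_one]
  have h2 (N : ℕ) : ∑ j ∈ Finset.range N, (ENNReal.ofReal (z j).1 *
      ∏ i ∈ Finset.range j, ENNReal.ofReal (1 - (z i).1)) +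
      ∏ i ∈ Finset.range N, ENNReal.ofReal (1 - (z i).1) = 1 := by
    induction N with
    | zero => simp
    | succ N ih =>
      have h3 : ENNReal.ofReal (z N).1 + ENNReal.ofReal (1 - (z N).1) = 1 := by
        rw [← ENNReal.ofReal_add (hz N).1.1.le (by linarith [(hz N).1.2])]; simp
      rw [Finset.sum_range_succ, Finset.prod_range_succ, add_assoc, mul_comm (∏ i ∈ _, _),
        ← add_mul, h3, one_mul, ih]
  exact ENNReal.tsum_le_of_sum_range_le fun N => (h2 N) ▸ le_self_add

/-- No mass is lost: splitting off the first innovation shows that the mean mass `x` satisfies `x =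
Eθ + E(1 - θ) x`, and `Eθ > 0` forces `x = 1`. A mass that is at most `1` with mean `1` equals `1`
almost surely. -/
lemma ae_isProbabilityMeasure_stickMeasure (α : Measure X) [IsFiniteMeasure α] (hα : α ≠ 0)
    (hn : 1 ≤ n) : ∀ᵐ z ∂Measure.infinitePi fun _ : ℕ => innovationLaw α n,
      IsProbabilityMeasure (stickMeasure z) := by
  have := isProbabilityMeasure_innovationLaw α hα hn
  set I := innovationLaw α n with hI
  have hgood : ∀ᵐ z ∂Measure.infinitePi fun _ : ℕ => I, ∀ j, (z j).1 ∈ Set.Ioo (0 : ℝ) 1 ∧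
      (z j).2.1 ∈ stdSimplex ℝ (Fin n) := by
    rw [ae_all_iff]
    exact fun j => (measurePreserving_eval_infinitePi (fun _ : ℕ => I) j).quasiMeasurePreserving.ae
      (ae_innovationLaw α hα hn)
  have hle : ∀ᵐ z ∂Measure.infinitePi fun _ : ℕ => I, stickMeasure z Set.univ ≤ 1 :=
    hgood.mono fun z hz => stickMeasure_univ_le_one hz
  have hm : Measurable fun z : ℕ → ℝ × (Fin n → ℝ) × (Fin n → X) => stickMeasure z Set.univ :=
    (Measure.measurable_coe .univ).comp measurable_stickMeasure
  set x := ∫⁻ z, stickMeasure z Set.univ ∂Measure.infinitePi fun _ : ℕ => I with hx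
  set t := ∫⁻ a, ENNReal.ofReal a.1 ∂I with ht
  set t' := ∫⁻ a, ENNReal.ofReal (1 - a.1) ∂I with ht'
  have h1 : x = t + t' * x := by
    conv_lhs => rw [hx, ← map_seqCons_prod_infinitePi I, lintegral_map hm measurable_seqCons]
    have : ∀ᵐ w ∂I.prod (Measure.infinitePi fun _ : ℕ => I), stickMeasure (seqCons w) Set.univ =
        ENNReal.ofReal w.1.1 + ENNReal.ofReal (1 - w.1.1) * stickMeasure w.2 Set.univ := by
      filter_upwards [Measure.quasiMeasurePreserving_fst.ae (ae_innovationLaw α hα hn)] with w hw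
      rw [stickMeasure_seqCons, mixture_univ hw.2]
    rw [lintegral_congr_ae this, lintegral_add_left (by fun_prop), lintegral_prod_mul
      (f := fun a : ℝ × (Fin n → ℝ) × (Fin n → X) => ENNReal.ofReal (1 - a.1)) (by fun_prop)
      hm.aemeasurable, lintegral_prod _ (by fun_prop)]
    simp [ht, ht', hx]
  have h2 : t + t' = 1 := by
    rw [ht, ht', ← lintegral_add_left (by fun_prop)]
    have : ∀ᵐ a ∂I, ENNReal.ofReal a.1 + ENNReal.ofReal (1 - a.1) = 1 := by
      filter_upwards [ae_innovationLaw α hα hn] with a ha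
      rw [← ENNReal.ofReal_add ha.1.1.le (by linarith [ha.1.2])]; simp
    rw [lintegral_congr_ae this]; simp
  have h3 : x ≤ 1 := (lintegral_mono_ae hle).trans (by simp)
  have h4 : t ≠ 0 := by
    rw [ht, Ne, lintegral_eq_zero_iff (by fun_prop)]
    intro h0
    have : ∀ᵐ a ∂I, False := by
      filter_upwards [h0, ae_innovationLaw α hα hn] with a ha ha'
      exact ha'.1.1.not_ge (ENNReal.ofReal_eq_zero.1 ha)
    exact IsProbabilityMeasure.ne_zero I (by simpa using this)
  have h5 : x = 1 := by
    have ht1 : t ≠ ∞ := ne_top_of_le_ne_top ENNReal.one_ne_top (h2 ▸ le_self_add)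
    have ht1' : t' ≠ ∞ := ne_top_of_le_ne_top ENNReal.one_ne_top (h2 ▸ le_add_self)
    have hx1 : x ≠ ∞ := ne_top_of_le_ne_top ENNReal.one_ne_top h3
    have e1 := congrArg ENNReal.toReal h1
    have e2 := congrArg ENNReal.toReal h2
    rw [ENNReal.toReal_add ht1 (ENNReal.mul_ne_top ht1' hx1), ENNReal.toReal_mul] at e1
    rw [ENNReal.toReal_add ht1 ht1', ENNReal.toReal_one] at e2
    have h6 : t.toReal ≠ 0 := ENNReal.toReal_ne_zero.2 ⟨h4, ht1⟩
    rw [← ENNReal.toReal_eq_one_iff]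
    refine mul_left_cancel₀ h6 ?_
    linear_combination e1 + x.toReal * e2
  have h6 := ae_eq_of_ae_le_of_lintegral_le hle (by rw [← hx, h5]; simp)
    aemeasurable_const (by rw [← hx, h5]; simp)
  exact h6.mono fun z hz => ⟨hz⟩

open Classical in
/-- `stickMeasure z` as a probability measure; equal to `μ₀` on the exceptional null set. -/
noncomputable def stickProbability (μ₀ : ProbabilityMeasure X)
    (z : ℕ → ℝ × (Fin n → ℝ) × (Fin n → X)) : ProbabilityMeasure X :=
  if h : IsProbabilityMeasure (stickMeasure z) then ⟨stickMeasure z, h⟩ else μ₀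

lemma coe_stickProbability (μ₀ : ProbabilityMeasure X)
    {z : ℕ → ℝ × (Fin n → ℝ) × (Fin n → X)} (h : IsProbabilityMeasure (stickMeasure z)) :
    (stickProbability μ₀ z : Measure X) = stickMeasure z := by
  simp [stickProbability, h]

lemma measurable_stickProbability (μ₀ : ProbabilityMeasure X) :
    Measurable (stickProbability (n := n) μ₀) := by
  classical
  refine Measurable.subtype_mk (f := fun z => (stickProbability (n := n) μ₀ z : Measure X)) ?_
  have : (fun z => (stickProbability (n := n) μ₀ z : Measure X)) = fun z =>
      if IsProbabilityMeasure (stickMeasure z) then stickMeasure z else (μ₀ : Measure X) := by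
    funext z
    by_cases h : IsProbabilityMeasure (stickMeasure z) <;> simp [stickProbability, h]
  rw [this]
  exact Measurable.ite (measurable_stickMeasure
    ProbabilityMeasure.measurableSet_isProbabilityMeasure) measurable_stickMeasure measurable_const

/-- A step from the series of `w.2` with innovation `w.1` is almost surely the series of the
prepended sequence, which has the original i.i.d. law. -/
lemma lintegral_comp_step_stickProbability (α : Measure X) [IsFiniteMeasure α] (hα : α ≠ 0)
    (hn : 1 ≤ n) (μ₀ : ProbabilityMeasure X) {f : ProbabilityMeasure X → ENNReal}
    (hf : Measurable f) :
    ∫⁻ w, f (step (stickProbability μ₀ w.2) w.1)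
        ∂((innovationLaw α n).prod (Measure.infinitePi fun _ : ℕ => innovationLaw α n)) =
      ∫⁻ z, f (stickProbability μ₀ z) ∂(Measure.infinitePi fun _ : ℕ => innovationLaw α n) := by
  have := isProbabilityMeasure_innovationLaw α hα hn
  have hfs : Measurable fun z : ℕ → ℝ × (Fin n → ℝ) × (Fin n → X) => f (stickProbability μ₀ z) :=
    hf.comp (measurable_stickProbability μ₀)
  have hr := lintegral_map (μ := (innovationLaw α n).prod
    (Measure.infinitePi fun _ : ℕ => innovationLaw α n)) hfs measurable_seqCons
  rw [map_seqCons_prod_infinitePi] at hr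
  refine Eq.trans (lintegral_congr_ae ?_) hr.symm
  have ha := Measure.quasiMeasurePreserving_fst (μ := innovationLaw α n)
    (ν := Measure.infinitePi fun _ : ℕ => innovationLaw α n) |>.ae (ae_innovationLaw α hα hn)
  have hb := Measure.quasiMeasurePreserving_snd (μ := innovationLaw α n)
    (ν := Measure.infinitePi fun _ : ℕ => innovationLaw α n) |>.ae
      (ae_isProbabilityMeasure_stickMeasure α hα hn)
  filter_upwards [ha, hb] with w hw1 hw2
  have h1 := isProbabilityMeasure_mixture hw1.1 hw1.2 w.1.2.2 (stickMeasure w.2)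
  have h2 : IsProbabilityMeasure (stickMeasure (seqCons w)) := by rwa [stickMeasure_seqCons]
  have e1 := coe_stickProbability μ₀ hw2
  have e2 := coe_stickProbability μ₀ h2
  rw [← e1] at h1
  have e3 : step (stickProbability μ₀ w.2) w.1 = stickProbability μ₀ (seqCons w) :=
    Subtype.ext ((coe_step h1).trans (e2.trans (by rw [stickMeasure_seqCons, e1])).symm)
  rw [e3]

lemma lintegral_bind_map_transitionKernel {Z : Type*} [MeasurableSpace Z] (α : Measure X)
    [SFinite (innovationLaw α n)] (ρ : Measure Z) [SFinite ρ] {g : Z → ProbabilityMeasure X}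
    (hg : Measurable g) {f : ProbabilityMeasure X → ENNReal} (hf : Measurable f) :
    ∫⁻ p, f p ∂((ρ.map g).bind (transitionKernel α n)) =
      ∫⁻ w, f (step (g w.2) w.1) ∂((innovationLaw α n).prod ρ) := by
  have hf' : Measurable fun w : ProbabilityMeasure X × (ℝ × (Fin n → ℝ) × (Fin n → X)) =>
    f (step w.1 w.2) := hf.comp measurable_step
  have hf'' : Measurable fun p : ProbabilityMeasure X =>
      ∫⁻ a, f (step p a) ∂innovationLaw α n := hf'.lintegral_prod_right'
  have h0 : Measurable fun w : (ℝ × (Fin n → ℝ) × (Fin n → X)) × Z => (g w.2, w.1) :=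
    (hg.comp measurable_snd).prodMk measurable_fst
  have h1 : Measurable fun w : (ℝ × (Fin n → ℝ) × (Fin n → X)) × Z => f (step (g w.2) w.1) :=
    hf'.comp h0
  rw [Measure.lintegral_bind (transitionKernel α n).aemeasurable hf.aemeasurable]
  simp_rw [lintegral_transitionKernel α n _ hf]
  rw [lintegral_map hf'' hg, lintegral_prod_symm _ h1.aemeasurable]

lemma invariant_map_stickProbability (α : Measure X) [IsFiniteMeasure α] (hα : α ≠ 0) (hn : 1 ≤ n)
    (μ₀ : ProbabilityMeasure X) :
    (transitionKernel α n).Invariant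
      ((Measure.infinitePi fun _ : ℕ => innovationLaw α n).map (stickProbability μ₀)) := by
  have := isProbabilityMeasure_innovationLaw α hα hn
  have hs := measurable_stickProbability (n := n) μ₀
  refine Measure.ext_of_lintegral _ fun f hf => ?_
  rw [lintegral_bind_map_transitionKernel α _ hs hf, lintegral_map hf hs,
    lintegral_comp_step_stickProbability α hα hn μ₀ hf]

lemma exists_invariant (α : Measure X) [IsFiniteMeasure α] (hα : α ≠ 0) (hn : 1 ≤ n) :
    ∃ Q : Measure (ProbabilityMeasure X),
      IsProbabilityMeasure Q ∧ (transitionKernel α n).Invariant Q := by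
  have := isProbabilityMeasure_innovationLaw α hα hn
  have : Nonempty X := by
    by_contra h
    rw [not_nonempty_iff] at h
    exact hα (Measure.eq_zero_of_isEmpty α)
  let μ₀ : ProbabilityMeasure X := ⟨Measure.dirac (Classical.arbitrary X), inferInstance⟩
  exact ⟨_, Measure.isProbabilityMeasure_map (measurable_stickProbability μ₀).aemeasurable,
    invariant_map_stickProbability α hα hn μ₀⟩

end Existence
end FeiginTweedie

theorem theorem3 {X : Type*} [TopologicalSpace X] [PolishSpace X] [MeasurableSpace X]
    [BorelSpace X] (α : Measure X) [IsFiniteMeasure α] (hα : α ≠ 0) (n : ℕ) (hn : 1 ≤ n) :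
    -- the process defined by the recursion is Markov with the stated transition kernel
    (∀ {Ω : Type*} [MeasurableSpace Ω] (Pr : Measure Ω) [IsProbabilityMeasure Pr]
      (θ : ℕ → Ω → ℝ) (q : ℕ → Ω → Fin n → ℝ) (Y : ℕ → Ω → Fin n → X)
      (P : ℕ → Ω → ProbabilityMeasure X), FeiginTweedie.IsChain α n Pr θ q Y P →
      ∀ m : ℕ, HasCondDistrib (P (m + 1)) (fun ω (i : Fin (m + 1)) => P i ω)
        ((FeiginTweedie.transitionKernel α n).comap (fun h => h (Fin.last m))
          (measurable_pi_apply _)) Pr) ∧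
    -- there is exactly one invariant probability measure
    (∃! Q : Measure (ProbabilityMeasure X),
      IsProbabilityMeasure Q ∧ (FeiginTweedie.transitionKernel α n).Invariant Q) ∧
    -- and it is the law of a Dirichlet process with parameter `α`
    ∀ Q : Measure (ProbabilityMeasure X),
      (IsProbabilityMeasure Q ∧ (FeiginTweedie.transitionKernel α n).Invariant Q) ↔
        FeiginTweedie.IsDirichletProcessLaw α Q := by
  obtain ⟨Q₀, hQ₀, hI₀⟩ := FeiginTweedie.exists_invariant α hα hn
  have hD₀ := FeiginTweedie.isDirichletProcessLaw_of_invariant α hα hn hI₀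
  refine ⟨fun Pr _ θ q Y P h m => h.hasCondDistrib hα hn m, ⟨Q₀, ⟨hQ₀, hI₀⟩, ?_⟩, fun Q => ⟨?_, ?_⟩⟩
  · rintro Q ⟨hQ, hI⟩
    exact (FeiginTweedie.isDirichletProcessLaw_of_invariant α hα hn hI).unique hD₀
  · rintro ⟨hQ, hI⟩
    exact FeiginTweedie.isDirichletProcessLaw_of_invariant α hα hn hI
  -- A Dirichlet process law is the only one for its parameter, hence it is the invariant law
  -- already constructed.
  · intro hQ
    rw [hQ.unique hD₀]
    exact ⟨hQ₀, hI₀⟩
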